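/- Let $(\mathfrak H,(\cdot,\cdot))$ be a complex Hilbert space, let $J$ be a bounded operator on $\mathfrak H$ with $J=J^*$, $J^2=I$, put $[f,g]=(Jf,g)$ and $\mathfrak H_\pm=\frac12(I\pm J)\mathfrak H$. A subspace $\mathfrak L$ is called positive (negative) if $[f,f]>0$ ($[f,f]<0$) for all nonzero $f\in\mathfrak L$; it is called maximal positive (negative) if it is closed, positive (negative) and not a proper subspace of a positive (negative) subspace. For a maximal positive subspace $\mathfrak L_+$ let $\mathfrak L_-=\{f:[f,g]=0\ \forall g\in\mathfrak L_+\}$, let $\mathcal D=\mathfrak L_+[\dot+]\mathfrak L_-$ be the resulting $J$-orthogonal direct sum, and let $\mathcal C$ be the operator of this direct sum: $D(\mathcal C)=\mathcal D$, $\mathcal C(f_++f_-)=f_+-f_-$ for $f_\pm\in\mathfrak L_\pm$. A transition operator of the direct sum is a bounded self-adjoint operator $T$ with $\|Tf\|<\|f\|$ for all $f\ne0$, $JT=-TJ$ and $\mathfrak L_\pm=(I+T)\mathfrak H_\pm$. Then: (a) Every operator $\mathcal C$ of such a direct sum is densely defined, and its adjoint $\mathcal C^*$ is again the operator of such a direct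 sum. (b) For every such direct sum $\mathfrak L_+[\dot+]\mathfrak L_-$ with operator $\mathcal C$, the subspace $J\mathfrak L_+$ is maximal positive, its $J$-orthogonal complement is $J\mathfrak L_-$, which is maximal negative, and $\mathcal C^*$ is the operator of the dual direct sum $J\mathfrak L_+[\dot+]J\mathfrak L_-$. The direct sum $\mathfrak L_+[\dot+]\mathfrak L_-$ has exactly one transition operator, and a bounded operator $T$ is its transition operator if and only if $-T$ is the transition operator of the dual direct sum. (c) If $\mathcal C=Je^{Q}$, where $Q$ is a (possibly unbounded) self-adjoint operator in $\mathfrak H$ with $JQ=-QJ$, then $\mathcal C^*=Je^{-Q}$, where $-Q$ is again self-adjoint and anticommutes with $J$. Moreover, $\mathcal C$ is the operator of some direct sum $\mathfrak L_+[\dot+]\mathfrak L_-$ as above, and $\mathcal C^*$ is the operator of the dual direct sum $J\mathfrak L_+[\dot+]J\mathfrak L_-$. -/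

import Mathlib

open scoped InnerProductSpace LinearPMap

noncomputable section

namespace Krein

variable {H : Type*} [NormedAddCommGroup H] [InnerProductSpace ℂ H]

/-- A fundamental symmetry: a bounded self-adjoint operator `J` with `J² = I`. -/
structure IsFundamentalSymmetry [CompleteSpace H] (J : H →L[ℂ] H) : Prop where
  isSelfAdjoint : IsSelfAdjoint J
  sq_eq_one : J * J = 1

/-- The indefinite inner product `[f, g] = (J f, g)`, where `(f, g)` is linear in `f`
(Mathlib's `⟪g, f⟫_ℂ`). -/
def indefInner (J : H →L[ℂ] H) (f g : H) : ℂ := ⟪g, J f⟫_ℂ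

/-- `[f, f] > 0` for all nonzero `f` in the subspace (the numbers `[f, f]` are real). -/
def IsPositive (J : H →L[ℂ] H) (L : Submodule ℂ H) : Prop :=
  ∀ f ∈ L, f ≠ 0 → 0 < (indefInner J f f).re

/-- `[f, f] < 0` for all nonzero `f` in the subspace. -/
def IsNegative (J : H →L[ℂ] H) (L : Submodule ℂ H) : Prop :=
  ∀ f ∈ L, f ≠ 0 → (indefInner J f f).re < 0

/-- A closed positive subspace that is not a proper subspace of a positive subspace. -/
structure IsMaximalPositive (J : H →L[ℂ] H) (L : Submodule ℂ H) : Prop where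
  isClosed : IsClosed (L : Set H)
  isPositive : IsPositive J L
  maximal : ∀ M : Submodule ℂ H, IsPositive J M → L ≤ M → M = L

/-- A closed negative subspace that is not a proper subspace of a negative subspace. -/
structure IsMaximalNegative (J : H →L[ℂ] H) (L : Submodule ℂ H) : Prop where
  isClosed : IsClosed (L : Set H)
  isNegative : IsNegative J L
  maximal : ∀ M : Submodule ℂ H, IsNegative J M → L ≤ M → M = L

/-- The `J`-orthogonal complement `{f | [f, g] = 0 for all g ∈ L}`. -/
def indefOrthogonal (J : H →L[ℂ] H) (L : Submodule ℂ H) : Submodule ℂ H where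
  carrier := {f | ∀ g ∈ L, indefInner J f g = 0}
  add_mem' := by
    intro a b ha hb g hg
    have h1 := ha g hg
    have h2 := hb g hg
    simp only [indefInner, map_add, inner_add_right] at *
    rw [h1, h2, add_zero]
  zero_mem' := by
    intro g _
    simp [indefInner]
  smul_mem' := by
    intro c a ha g hg
    have h1 := ha g hg
    simp only [indefInner, map_smul, inner_smul_right] at *
    rw [h1, mul_zero]

/-- The pair `L₊`, `L₋` of a `J`-orthogonal direct sum: `L₊` is maximal positive and
`L₋` is its `J`-orthogonal complement. -/
structure IsDirectSumPair (J : H →L[ℂ] H) (Lp Lm : Submodule ℂ H) : Prop where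
  maximalPositive : IsMaximalPositive J Lp
  eq_orthogonal : Lm = indefOrthogonal J Lp

/-- The operator with domain `L₊ + L₋` and `f₊ + f₋ ↦ f₊ - f₋`, given by its graph
`{(f₊ + f₋, f₊ - f₋)}` (which is single-valued when `L₊ ∩ L₋ = {0}`). -/
def directSumOperator (Lp Lm : Submodule ℂ H) : H →ₗ.[ℂ] H :=
  ((Lp.prod Lm).map
    ((LinearMap.fst ℂ H H + LinearMap.snd ℂ H H).prod
      (LinearMap.fst ℂ H H - LinearMap.snd ℂ H H))).toLinearPMap

/-- The image `J L` of a subspace. -/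
def image (J : H →L[ℂ] H) (L : Submodule ℂ H) : Submodule ℂ H :=
  L.map (J : H →ₗ[ℂ] H)

/-- `H₊ = ½ (I + J) H`. -/
def fundPlus (J : H →L[ℂ] H) : Submodule ℂ H :=
  image ((2 : ℂ)⁻¹ • (1 + J)) ⊤

/-- `H₋ = ½ (I - J) H`. -/
def fundMinus (J : H →L[ℂ] H) : Submodule ℂ H :=
  image ((2 : ℂ)⁻¹ • (1 - J)) ⊤

/-- `T` is an operator of transition from the fundamental decomposition `H₊ [⊕] H₋` to the pair
`L₊`, `L₋`: a self-adjoint strong contraction that anticommutes with `J` and satisfies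
`L₊ = (I + T) H₊`, `L₋ = (I + T) H₋`. -/
structure IsTransitionOperator [CompleteSpace H] (J T : H →L[ℂ] H) (Lp Lm : Submodule ℂ H) :
    Prop where
  isSelfAdjoint : IsSelfAdjoint T
  strong_contraction : ∀ f : H, f ≠ 0 → ‖T f‖ < ‖f‖
  anticommute : J * T = -(T * J)
  plus_eq : Lp = image (1 + T) (fundPlus J)
  minus_eq : Lm = image (1 + T) (fundMinus J)

/-- `J Q = -Q J` for a partially defined operator `Q`, domains included. -/
structure Anticommutes (J : H →L[ℂ] H) (Q : H →ₗ.[ℂ] H) : Prop where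
  mem_domain_iff : ∀ x : H, J x ∈ Q.domain ↔ x ∈ Q.domain
  apply_eq : ∀ (x : Q.domain) (hx : J x ∈ Q.domain), J (Q x) = -Q ⟨J x, hx⟩

/-- A projection-valued measure (resolution of the identity) on the Borel sets of `ℝ`.
Only the values at Borel sets matter. -/
structure SpectralMeasure (H : Type*) [NormedAddCommGroup H] [InnerProductSpace ℂ H]
    [CompleteSpace H] where
  proj : Set ℝ → H →L[ℂ] H
  isSelfAdjoint : ∀ S, MeasurableSet S → IsSelfAdjoint (proj S)
  proj_univ : proj Set.univ = 1
  proj_inter : ∀ S T, MeasurableSet S → MeasurableSet T → proj (S ∩ T) = proj S * proj T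
  hasSum : ∀ S : ℕ → Set ℝ, (∀ i, MeasurableSet (S i)) →
    Pairwise (Function.onFun Disjoint S) →
    ∀ x : H, HasSum (fun i => proj (S i) x) (proj (⋃ i, S i) x)

namespace SpectralMeasure

variable [CompleteSpace H]

theorem re_inner_nonneg (E : SpectralMeasure H) (x : H) {S : Set ℝ} (hS : MeasurableSet S) :
    0 ≤ (⟪x, E.proj S x⟫_ℂ).re := by
  have h1 : E.proj S = E.proj S * E.proj S := by
    rw [← E.proj_inter S S hS hS, Set.inter_self]
  have h2 : ⟪x, E.proj S x⟫_ℂ = ⟪E.proj S x, E.proj S x⟫_ℂ := by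
    conv_lhs => rw [h1]
    have h3 := E.isSelfAdjoint S hS
    rw [ContinuousLinearMap.isSelfAdjoint_iff_isSymmetric] at h3
    exact (h3 x (E.proj S x)).symm
  rw [h2]
  exact inner_self_nonneg (𝕜 := ℂ) (x := E.proj S x)

theorem proj_empty (E : SpectralMeasure H) (x : H) : E.proj ∅ x = 0 := by
  have h := E.hasSum (fun _ => ∅) (fun _ => MeasurableSet.empty)
    (fun _ _ _ => disjoint_bot_left) x
  exact tendsto_nhds_unique tendsto_const_nhds h.summable.tendsto_atTop_zero

/-- The scalar measure `μ_x(S) = (E(S) x, x)`. -/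
def scalar (E : SpectralMeasure H) (x : H) : MeasureTheory.Measure ℝ :=
  MeasureTheory.Measure.ofMeasurable (fun S _ => ENNReal.ofReal (⟪x, E.proj S x⟫_ℂ).re)
    (by simp [E.proj_empty x])
    (by
      intro S hS hd
      have h1 := (E.hasSum S hS hd x).mapL (innerSL ℂ x)
      have h2 := Complex.hasSum_re h1
      simp only [innerSL_apply_apply] at h2
      rw [← h2.tsum_eq]
      exact ENNReal.ofReal_tsum_of_nonneg (fun i => E.re_inner_nonneg x (hS i)) h2.summable)

/-- `A = ∫ f dE` for a real Borel function `f`: the domain of `A` is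
`{x | ∫ |f|² dμ_x < ∞}` and `(A x, x) = ∫ f dμ_x` on it (by polarization this determines `A`). -/
structure IsIntegral (E : SpectralMeasure H) (f : ℝ → ℝ) (A : H →ₗ.[ℂ] H) : Prop where
  mem_domain_iff : ∀ x : H, x ∈ A.domain ↔ ∫⁻ t, ENNReal.ofReal (f t ^ 2) ∂(E.scalar x) < ⊤
  inner_eq : ∀ x : A.domain, ⟪(x : H), A x⟫_ℂ = ((∫ t, f t ∂(E.scalar (x : H)) : ℝ) : ℂ)

end SpectralMeasure

/-- `A = e^Q` in the functional calculus of the self-adjoint operator `Q`: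
`Q = ∫ t dE(t)` and `A = ∫ e^t dE(t)`, where `E` is the spectral measure of `Q`. -/
def IsExp [CompleteSpace H] (Q A : H →ₗ.[ℂ] H) : Prop :=
  ∃ E : SpectralMeasure H, E.IsIntegral (fun t => t) Q ∧ E.IsIntegral Real.exp A

/-- `C = J e^Q` with a self-adjoint operator `Q` such that `J Q = -Q J`. -/
structure IsExpForm [CompleteSpace H] (J : H →L[ℂ] H) (Q C : H →ₗ.[ℂ] H) : Prop where
  isSelfAdjoint : IsSelfAdjoint Q
  anticommutes : Anticommutes J Q
  eq_comp : ∃ A : H →ₗ.[ℂ] H, IsExp Q A ∧ C = (J : H →ₗ[ℂ] H).compPMap A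

/-- `C` is the operator of some `J`-orthogonal direct sum. -/
def IsCOperator (J : H →L[ℂ] H) (C : H →ₗ.[ℂ] H) : Prop :=
  ∃ Lp Lm : Submodule ℂ H, IsDirectSumPair J Lp Lm ∧ C = directSumOperator Lp Lm

end Krein

end

noncomputable section

namespace Krein

variable {H : Type*} [NormedAddCommGroup H] [InnerProductSpace ℂ H]

/-! A maximal positive subspace `L₊` meets `H₋` trivially and projects onto `H₊`
(`IsMaximalPositive.exists_add_eq`), so it is the graph of a strict contraction `K : H₊ → H₋`. Then
`T = K + K*` is self-adjoint, anticommutes with `J`, and satisfies `L₊ = (I + T)H₊`; the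
`J`-orthogonal complement of `L₊` is `(I + T)H₋`. This is the transition operator
(`exists_transition`).

In terms of `T` the graph of `C` is `{((I + T)x, (I + T)Jx)}`. Its domain is the range of `I + T`,
dense because `I + T` is self-adjoint and injective. A pair `(y, z)` lies in the graph of `C*` iff
`(I - T)Jy = (I + T)z`, and this equation is solved by `y = (I - T)w`, `z = (I - T)Jw` with `w = (y
+ Jz)/2`. So `C*` has the same form with `-T` in place of `T`. Since `J(I + T) = (I - T)J`, the
operator `-T` belongs to the pair `JL₊`, `JL₋`. This gives (a) and (b).

For (c), `JQJ = -Q` and uniqueness of the spectral measure show that conjugation by `J` reflects the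
spectral measure of `Q` in the origin. Hence `Je^QJ` is the inverse of `e^Q`, and `C = Je^Q` is an
involution on its domain. Its eigenspaces for `1` and `-1` are the required `L₊` and `L₋`: they are
`J`-orthogonal because `e^Q` is symmetric, `L₊` is positive because `e^t > 0`, and they project onto
`H₊` and `H₋` because `I + e^Q` is onto. By (b), `C* = JCJ = J(Je^QJ)`, and `Je^QJ = e^{-Q}`. -/

theorem mem_image {J : H →L[ℂ] H} {L : Submodule ℂ H} {x : H} :
    x ∈ image J L ↔ ∃ y ∈ L, J y = x := by
  simp [image]

theorem image_image (J T : H →L[ℂ] H) (L : Submodule ℂ H) :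
    image J (image T L) = image (J * T) L := by
  ext x
  simp only [mem_image]
  constructor
  · rintro ⟨y, ⟨z, hz, rfl⟩, rfl⟩
    exact ⟨z, hz, rfl⟩
  · rintro ⟨z, hz, rfl⟩
    exact ⟨T z, ⟨z, hz, rfl⟩, rfl⟩

theorem mem_indefOrthogonal {J : H →L[ℂ] H} {L : Submodule ℂ H} {f : H} :
    f ∈ indefOrthogonal J L ↔ ∀ g ∈ L, ⟪g, J f⟫_ℂ = 0 := Iff.rfl

theorem image_mono (J : H →L[ℂ] H) {L M : Submodule ℂ H} (h : L ≤ M) : image J L ≤ image J M :=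
  Submodule.map_mono h

theorem isClosed_indefOrthogonal (J : H →L[ℂ] H) (L : Submodule ℂ H) :
    IsClosed (indefOrthogonal J L : Set H) := by
  have : (indefOrthogonal J L : Set H) = ⋂ g ∈ L, {f | ⟪g, J f⟫_ℂ = 0} := by
    ext f
    simp [mem_indefOrthogonal]
  rw [this]
  exact isClosed_biInter fun g _ =>
    isClosed_eq (continuous_const.inner J.continuous) continuous_const

theorem half_add_half (x y : H) : (2 : ℂ)⁻¹ • (x + y) + (2 : ℂ)⁻¹ • (x - y) = x := by
  module

/-! ### Geometry of a fundamental symmetry and criteria for maximality -/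

section FundamentalSymmetry

variable [CompleteSpace H] {J : H →L[ℂ] H}

namespace IsFundamentalSymmetry

theorem apply_apply (hJ : IsFundamentalSymmetry J) (x : H) : J (J x) = x := by
  have := congrArg (fun A : H →L[ℂ] H => A x) hJ.sq_eq_one
  simpa using this

theorem inner_left (hJ : IsFundamentalSymmetry J) (x y : H) : ⟪J x, y⟫_ℂ = ⟪x, J y⟫_ℂ :=
  (ContinuousLinearMap.isSelfAdjoint_iff_isSymmetric.1 hJ.isSelfAdjoint) x y

theorem inner_apply_apply (hJ : IsFundamentalSymmetry J) (x y : H) :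
    ⟪J x, J y⟫_ℂ = ⟪x, y⟫_ℂ := by
  rw [hJ.inner_left, hJ.apply_apply]

theorem injective (hJ : IsFundamentalSymmetry J) : Function.Injective J :=
  Function.LeftInverse.injective (g := J) hJ.apply_apply

theorem mem_fundPlus (hJ : IsFundamentalSymmetry J) {x : H} : x ∈ fundPlus J ↔ J x = x := by
  rw [fundPlus, mem_image]
  constructor
  · rintro ⟨y, -, rfl⟩
    simp [hJ.apply_apply, add_comm]
  · intro h
    refine ⟨x, trivial, ?_⟩
    simp only [smul_apply, add_apply, one_apply_eq_self, h]
    module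

theorem mem_fundMinus (hJ : IsFundamentalSymmetry J) {x : H} :
    x ∈ fundMinus J ↔ J x = -x := by
  rw [fundMinus, mem_image]
  constructor
  · rintro ⟨y, -, rfl⟩
    simp [hJ.apply_apply, ← smul_neg]
  · intro h
    refine ⟨x, trivial, ?_⟩
    simp only [smul_apply, sub_apply, one_apply_eq_self, h]
    module

/-- Vectors of `H₊` are orthogonal to vectors of `H₋`. -/
theorem inner_eq_zero (hJ : IsFundamentalSymmetry J) {x y : H} (hx : J x = x) (hy : J y = -y) :
    ⟪x, y⟫_ℂ = 0 := by
  have h := hJ.inner_left x y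
  rw [hx, hy, inner_neg_right] at h
  exact self_eq_neg.1 h

theorem norm_add_sq (hJ : IsFundamentalSymmetry J) {x y : H} (hx : J x = x) (hy : J y = -y) :
    ‖x + y‖ ^ 2 = ‖x‖ ^ 2 + ‖y‖ ^ 2 := by
  have := @_root_.norm_add_sq ℂ H _ _ _ x y
  rw [hJ.inner_eq_zero hx hy] at this
  simpa using this

theorem re_indefInner_add (hJ : IsFundamentalSymmetry J) {x y : H} (hx : J x = x)
    (hy : J y = -y) : (indefInner J (x + y) (x + y)).re = ‖x‖ ^ 2 - ‖y‖ ^ 2 := by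
  have h0 : ⟪y, x⟫_ℂ = 0 := by rw [← inner_conj_symm, hJ.inner_eq_zero hx hy, map_zero]
  have h1 : ∀ z : H, (⟪z, z⟫_ℂ).re = ‖z‖ ^ 2 := fun z => (norm_sq_eq_re_inner (𝕜 := ℂ) z).symm
  rw [indefInner, map_add, hx, hy, inner_add_left, inner_add_right, inner_add_right,
    inner_neg_right, inner_neg_right, hJ.inner_eq_zero hx hy, h0]
  simp only [add_zero, zero_add, neg_zero, Complex.add_re, Complex.neg_re, h1, sub_eq_add_neg]

theorem indefInner_apply_apply (hJ : IsFundamentalSymmetry J) (x y : H) :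
    indefInner J (J x) (J y) = indefInner J x y := by
  rw [indefInner, hJ.inner_apply_apply, indefInner]

theorem image_image_self (hJ : IsFundamentalSymmetry J) (L : Submodule ℂ H) :
    image J (image J L) = L := by
  rw [image_image, hJ.sq_eq_one]
  ext x
  simp [mem_image]

theorem mem_image_iff (hJ : IsFundamentalSymmetry J) {L : Submodule ℂ H} {x : H} :
    x ∈ image J L ↔ J x ∈ L := by
  rw [mem_image]
  constructor
  · rintro ⟨y, hy, rfl⟩
    rwa [hJ.apply_apply]
  · intro h
    exact ⟨_, h, hJ.apply_apply x⟩

/-- The component of `x` in `H₊`. -/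
theorem half_add_mem (hJ : IsFundamentalSymmetry J) (x : H) :
    J ((2 : ℂ)⁻¹ • (x + J x)) = (2 : ℂ)⁻¹ • (x + J x) := by
  simp [hJ.apply_apply, add_comm]

theorem half_sub_mem (hJ : IsFundamentalSymmetry J) (x : H) :
    J ((2 : ℂ)⁻¹ • (x - J x)) = -((2 : ℂ)⁻¹ • (x - J x)) := by
  simp [hJ.apply_apply, ← smul_neg]

theorem isClosed_image (hJ : IsFundamentalSymmetry J) {L : Submodule ℂ H}
    (hL : IsClosed (L : Set H)) : IsClosed (image J L : Set H) := by
  have : (image J L : Set H) = J ⁻¹' L := by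
    ext x
    exact hJ.mem_image_iff
  rw [this]
  exact hL.preimage J.continuous

theorem isPositive_image (hJ : IsFundamentalSymmetry J) {L : Submodule ℂ H}
    (hL : IsPositive J L) : IsPositive J (image J L) := by
  intro f hf h0
  rw [← hJ.indefInner_apply_apply]
  exact hL _ (hJ.mem_image_iff.1 hf) fun h => h0 (hJ.injective (by simpa using h))

theorem isNegative_image (hJ : IsFundamentalSymmetry J) {L : Submodule ℂ H}
    (hL : IsNegative J L) : IsNegative J (image J L) := by
  intro f hf h0
  rw [← hJ.indefInner_apply_apply]
  exact hL _ (hJ.mem_image_iff.1 hf) fun h => h0 (hJ.injective (by simpa using h))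

theorem isMaximalPositive_image (hJ : IsFundamentalSymmetry J) {L : Submodule ℂ H}
    (hL : IsMaximalPositive J L) : IsMaximalPositive J (image J L) where
  isClosed := hJ.isClosed_image hL.isClosed
  isPositive := hJ.isPositive_image hL.isPositive
  maximal M hM h := by
    have h1 := hL.maximal (image J M) (hJ.isPositive_image hM)
      (by simpa [hJ.image_image_self] using image_mono J h)
    rw [← h1, hJ.image_image_self]

theorem isMaximalNegative_image (hJ : IsFundamentalSymmetry J) {L : Submodule ℂ H}
    (hL : IsMaximalNegative J L) : IsMaximalNegative J (image J L) where
  isClosed := hJ.isClosed_image hL.isClosed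
  isNegative := hJ.isNegative_image hL.isNegative
  maximal M hM h := by
    have h1 := hL.maximal (image J M) (hJ.isNegative_image hM)
      (by simpa [hJ.image_image_self] using image_mono J h)
    rw [← h1, hJ.image_image_self]

theorem indefOrthogonal_image (hJ : IsFundamentalSymmetry J) (L : Submodule ℂ H) :
    indefOrthogonal J (image J L) = image J (indefOrthogonal J L) := by
  ext f
  rw [hJ.mem_image_iff, mem_indefOrthogonal, mem_indefOrthogonal]
  constructor
  · intro h g hg
    rw [← hJ.inner_left]
    exact h _ (mem_image.2 ⟨g, hg, rfl⟩)
  · intro h g hg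
    obtain ⟨y, hy, rfl⟩ := mem_image.1 hg
    rw [hJ.inner_left]
    exact h y hy

theorem isDirectSumPair_image (hJ : IsFundamentalSymmetry J) {Lp Lm : Submodule ℂ H}
    (h : IsDirectSumPair J Lp Lm) : IsDirectSumPair J (image J Lp) (image J Lm) where
  maximalPositive := hJ.isMaximalPositive_image h.maximalPositive
  eq_orthogonal := by rw [hJ.indefOrthogonal_image, h.eq_orthogonal]

/-- A closed positive subspace that projects onto `H₊` is maximal positive. -/
theorem isMaximalPositive_of_surj (hJ : IsFundamentalSymmetry J) {L : Submodule ℂ H}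
    (hc : IsClosed (L : Set H)) (hp : IsPositive J L)
    (hs : ∀ h, J h = h → ∃ l ∈ L, l + J l = (2 : ℂ) • h) : IsMaximalPositive J L where
  isClosed := hc
  isPositive := hp
  maximal M hM hle := by
    refine le_antisymm (fun f hf => ?_) hle
    -- `l` is chosen with the same `H₊`-component as `f`. Then `f - l` is in `M` and in `H₋`, where
    -- the form is negative.
    obtain ⟨l, hl, e⟩ := hs _ (hJ.half_add_mem f)
    rw [smul_smul, mul_inv_cancel₀ two_ne_zero, one_smul] at e
    by_contra hfl
    have hne : f - l ≠ 0 := fun h0 => hfl (by rwa [sub_eq_zero.1 h0])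
    have hneg : J (f - l) = -(f - l) := by
      rw [map_sub]
      linear_combination (norm := module) -e
    have h1 := hM _ (M.sub_mem hf (hle hl)) hne
    have h2 := hJ.re_indefInner_add (x := 0) (map_zero J) hneg
    simp only [zero_add, norm_zero] at h2
    rw [h2] at h1
    nlinarith [sq_nonneg ‖f - l‖]

/-- A closed negative subspace that projects onto `H₋` is maximal negative. -/
theorem isMaximalNegative_of_surj (hJ : IsFundamentalSymmetry J) {L : Submodule ℂ H}
    (hc : IsClosed (L : Set H)) (hp : IsNegative J L)
    (hs : ∀ h, J h = -h → ∃ l ∈ L, l - J l = (2 : ℂ) • h) : IsMaximalNegative J L where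
  isClosed := hc
  isNegative := hp
  maximal M hM hle := by
    refine le_antisymm (fun f hf => ?_) hle
    obtain ⟨l, hl, e⟩ := hs _ (hJ.half_sub_mem f)
    rw [smul_smul, mul_inv_cancel₀ two_ne_zero, one_smul] at e
    by_contra hfl
    have hne : f - l ≠ 0 := fun h0 => hfl (by rwa [sub_eq_zero.1 h0])
    have hpos : J (f - l) = f - l := by
      rw [map_sub]
      linear_combination (norm := module) e
    have h1 := hM _ (M.sub_mem hf (hle hl)) hne
    have h2 := hJ.re_indefInner_add (y := 0) hpos (by simp)
    simp only [add_zero, norm_zero] at h2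
    rw [h2] at h1
    nlinarith [sq_nonneg ‖f - l‖]

end IsFundamentalSymmetry

/-- A maximal positive subspace projects onto `H₊`. -/
theorem IsMaximalPositive.exists_add_eq (hJ : IsFundamentalSymmetry J) {L : Submodule ℂ H}
    (hL : IsMaximalPositive J L) {h : H} (hh : J h = h) : ∃ l ∈ L, l + J l = (2 : ℂ) • h := by
  have : CompleteSpace L := hL.isClosed.completeSpace_coe
  -- Nonnegativity of `[l, l]` makes the `H₋`-component no longer than the `H₊`-component. So `l ↦ l
  -- + Jl` is bounded below on `L` and its range is closed.
  have key : ∀ l ∈ L, ‖l‖ ≤ ‖l + J l‖ := by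
    intro l hl
    have e := hJ.norm_add_sq (hJ.half_add_mem l) (hJ.half_sub_mem l)
    have e2 := hJ.re_indefInner_add (hJ.half_add_mem l) (hJ.half_sub_mem l)
    rw [half_add_half] at e e2
    have h0 : 0 ≤ (indefInner J l l).re := by
      rcases eq_or_ne l 0 with rfl | h0
      · simp [indefInner]
      · exact (hL.isPositive l hl h0).le
    rw [norm_smul] at e e2
    norm_num at e e2
    nlinarith [norm_nonneg l, norm_nonneg (l + J l)]
  let S : L →L[ℂ] H := (1 + J).comp L.subtypeL
  have hS : AntilipschitzWith 1 S := by
    refine S.antilipschitz_of_bound fun x => ?_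
    simpa [S] using key x x.2
  have hcl : IsClosed (LinearMap.range (S : L →ₗ[ℂ] H) : Set H) :=
    hS.isClosed_range S.uniformContinuous
  have : CompleteSpace (LinearMap.range (S : L →ₗ[ℂ] H)) := hcl.completeSpace_coe
  set W := LinearMap.range (S : L →ₗ[ℂ] H) with hW
  have memW : ∀ x, x ∈ W ↔ ∃ l ∈ L, l + J l = x := by
    intro x
    simp [W, S]
  obtain ⟨w, hw, g, hg, e⟩ := W.exists_add_mem_mem_orthogonal h
  have hwJ : J w = w := by
    obtain ⟨l, -, rfl⟩ := (memW w).1 hw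
    rw [map_add, hJ.apply_apply, add_comm]
  have hgJ : J g = g := by
    have : g = h - w := by rw [e]; abel
    rw [this, map_sub, hh, hwJ]
  have hort : ∀ l ∈ L, ⟪l, g⟫_ℂ = 0 := by
    intro l hl
    have h1 := (Submodule.mem_orthogonal _ _).1 hg (l + J l) ((memW _).2 ⟨l, hl, rfl⟩)
    rw [inner_add_left, hJ.inner_left, hgJ, ← two_mul] at h1
    simpa using h1
  -- The remainder `g` lies in `H₊` and is orthogonal to `L`, so adjoining it keeps the subspace
  -- positive. Maximality puts `g` in `L`, hence `g` is orthogonal to itself.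
  have hg0 : g = 0 := by
    have hM : IsPositive J (L ⊔ Submodule.span ℂ {g}) := by
      intro f hf h0
      obtain ⟨l, hl, y, hy, rfl⟩ := Submodule.mem_sup.1 hf
      obtain ⟨c, rfl⟩ := Submodule.mem_span_singleton.1 hy
      have h1 : indefInner J (l + c • g) (l + c • g)
          = indefInner J l l + ⟪c • g, c • g⟫_ℂ := by
        have h2 : ⟪l, c • g⟫_ℂ = 0 := by rw [inner_smul_right, hort l hl, mul_zero]
        have h3 : ⟪c • g, J l⟫_ℂ = 0 := by
          rw [← hJ.inner_left, map_smul, hgJ, ← inner_conj_symm, h2, map_zero]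
        rw [indefInner, map_add, map_smul, hgJ, inner_add_left, inner_add_right, inner_add_right,
          h2, h3, indefInner]
        ring
      have h4 : (⟪c • g, c • g⟫_ℂ).re = ‖c • g‖ ^ 2 := (norm_sq_eq_re_inner (𝕜 := ℂ) _).symm
      rw [h1, Complex.add_re, h4]
      rcases eq_or_ne l 0 with rfl | hl0
      · have : 0 < ‖c • g‖ := norm_pos_iff.2 (by simpa using h0)
        simp only [indefInner, inner_zero_left, Complex.zero_re, zero_add]
        positivity
      · have := hL.isPositive l hl hl0
        positivity
    have h1 := hL.maximal _ hM le_sup_left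
    have hgL : g ∈ L := by
      rw [← h1]
      exact Submodule.mem_sup_right (Submodule.mem_span_singleton_self g)
    exact inner_self_eq_zero.1 (hort g hgL)
  obtain ⟨l, hl, hl2⟩ := (memW w).1 hw
  refine ⟨(2 : ℂ) • l, L.smul_mem _ hl, ?_⟩
  rw [e, hg0, add_zero, ← hl2, map_smul, smul_add]

end FundamentalSymmetry

/-! ### Existence of the transition operator -/

section Transition

variable [CompleteSpace H] {J : H →L[ℂ] H}

namespace IsFundamentalSymmetry

theorem isClosed_fundMinus (hJ : IsFundamentalSymmetry J) :
    IsClosed (fundMinus J : Set H) := by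
  have : (fundMinus J : Set H) = {x | J x = -x} := by
    ext x
    exact hJ.mem_fundMinus
  rw [this]
  exact isClosed_eq J.continuous continuous_neg

theorem isCompl_fundMinus (hJ : IsFundamentalSymmetry J) {L : Submodule ℂ H}
    (hL : IsMaximalPositive J L) : IsCompl L (fundMinus J) := by
  constructor
  · rw [Submodule.disjoint_def]
    intro x hx hx2
    by_contra h0
    have h1 := hL.isPositive x hx h0
    have h2 := hJ.re_indefInner_add (x := 0) (map_zero J) (hJ.mem_fundMinus.1 hx2)
    simp only [zero_add, norm_zero] at h2
    nlinarith [sq_nonneg ‖x‖]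
  · rw [codisjoint_iff, eq_top_iff]
    intro x _
    obtain ⟨l, hl, e⟩ := hL.exists_add_eq hJ (hJ.half_add_mem x)
    rw [smul_smul, mul_inv_cancel₀ two_ne_zero, one_smul] at e
    have : x = l + (x - l) := by abel
    rw [this]
    refine Submodule.add_mem_sup hl (hJ.mem_fundMinus.2 ?_)
    rw [map_sub]
    linear_combination (norm := module) -e

/-- The hypotheses express that `K` kills `H₋` and takes values in `H₋`. The adjoint then kills `H₊`
and takes values in `H₊`, so `K + K*` interchanges the two spaces. -/
theorem adjoint_symmetry (hJ : IsFundamentalSymmetry J) {K : H →L[ℂ] H}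
    (h1 : ∀ x, J (K x) = -K x) (h2 : ∀ x, K (J x) = K x) :
    (∀ x, J (K.adjoint x) = K.adjoint x) ∧ ∀ x, K.adjoint (J x) = -K.adjoint x := by
  constructor
  · intro x
    refine ext_inner_left ℂ fun y => ?_
    rw [← hJ.inner_left, ContinuousLinearMap.adjoint_inner_right,
      ContinuousLinearMap.adjoint_inner_right, h2]
  · intro x
    refine ext_inner_left ℂ fun y => ?_
    rw [inner_neg_right, ContinuousLinearMap.adjoint_inner_right,
      ContinuousLinearMap.adjoint_inner_right, ← hJ.inner_left, h1, inner_neg_left]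

/-- If `T` is self-adjoint and anticommutes with `J`, the `J`-orthogonal complement of
`(I + T) H₊` is `(I + T) H₋`. -/
theorem indefOrthogonal_image_fundPlus (hJ : IsFundamentalSymmetry J) {T : H →L[ℂ] H}
    (hT : IsSelfAdjoint T) (ha : ∀ x, J (T x) = -T (J x)) :
    indefOrthogonal J (image (1 + T) (fundPlus J)) = image (1 + T) (fundMinus J) := by
  have hs : ∀ x y, ⟪T x, y⟫_ℂ = ⟪x, T y⟫_ℂ :=
    ContinuousLinearMap.isSelfAdjoint_iff_isSymmetric.1 hT
  ext f
  rw [mem_indefOrthogonal]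
  constructor
  · intro h
    have h1 : ∀ x, J x = x → ⟪x, J f + T (J f)⟫_ℂ = 0 := by
      intro x hx
      have := h _ (mem_image.2 ⟨x, hJ.mem_fundPlus.2 hx, rfl⟩)
      simp only [add_apply, one_apply_eq_self, inner_add_left, hs] at this
      rwa [inner_add_right]
    -- Testing against the `H₊`-component of `w = (I + T)Jf` itself shows that this component
    -- vanishes. Expanded, that is `f + Jf = T(f - Jf)`, so `f = (I + T)b` with `b` the
    -- `H₋`-component of `f`.
    have h2 := h1 _ (hJ.half_add_mem (J f + T (J f)))
    have h3 : ⟪(2 : ℂ)⁻¹ • ((J f + T (J f)) + J (J f + T (J f))),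
        (2 : ℂ)⁻¹ • ((J f + T (J f)) - J (J f + T (J f)))⟫_ℂ = 0 :=
      hJ.inner_eq_zero (hJ.half_add_mem _) (hJ.half_sub_mem _)
    rw [← half_add_half (J f + T (J f)) (J (J f + T (J f))), inner_add_right] at h2
    rw [half_add_half, h3, add_zero, inner_self_eq_zero] at h2
    simp only [map_add, hJ.apply_apply, ha] at h2
    refine mem_image.2 ⟨(2 : ℂ)⁻¹ • (f - J f), hJ.mem_fundMinus.2 (hJ.half_sub_mem f), ?_⟩
    simp only [add_apply, one_apply_eq_self, map_smul, map_sub]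
    linear_combination (norm := module) -h2
  · intro h g hg
    obtain ⟨b, hb, rfl⟩ := mem_image.1 h
    obtain ⟨a, ha', rfl⟩ := mem_image.1 hg
    rw [hJ.mem_fundMinus] at hb
    rw [hJ.mem_fundPlus] at ha'
    have h1 : ⟪a, b⟫_ℂ = 0 := hJ.inner_eq_zero ha' hb
    have h2 : ⟪T a, T b⟫_ℂ = 0 := by
      rw [← inner_conj_symm, hJ.inner_eq_zero (x := T b) (y := T a), map_zero]
      · rw [ha, hb, map_neg, neg_neg]
      · rw [ha, ha']
    simp only [add_apply, one_apply_eq_self, map_add, ha, hb, map_neg, neg_neg, inner_add_left,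
      inner_add_right, inner_neg_right, h1, h2, hs]
    ring

theorem isNegative_image_fundMinus (hJ : IsFundamentalSymmetry J) {T : H →L[ℂ] H}
    (ha : ∀ x, J (T x) = -T (J x)) (hc : ∀ x, x ≠ 0 → ‖T x‖ < ‖x‖) :
    IsNegative J (image (1 + T) (fundMinus J)) := by
  intro f hf h0
  obtain ⟨b, hb, rfl⟩ := mem_image.1 hf
  rw [hJ.mem_fundMinus] at hb
  have hb0 : b ≠ 0 := by
    rintro rfl
    simp at h0
  have h1 : J (T b) = T b := by rw [ha, hb, map_neg, neg_neg]
  have h2 := hJ.re_indefInner_add h1 hb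
  have h3 := hc b hb0
  simp only [add_apply, one_apply_eq_self]
  rw [add_comm, h2]
  nlinarith [norm_nonneg (T b)]

/-- `L` and `H₋` are closed complements, so the projection `S` onto `L` along `H₋` is bounded. With
`Pp` the projection onto `H₊`, the operator `K = S Pp - Pp` sends `x` in `H₊` to the `H₋`-part of
the vector of `L` lying over `x`. -/
theorem exists_transition (hJ : IsFundamentalSymmetry J) {L : Submodule ℂ H}
    (hL : IsMaximalPositive J L) :
    ∃ T : H →L[ℂ] H, IsTransitionOperator J T L (indefOrthogonal J L) := by
  have hC := Submodule.IsCompl.isTopCompl_of_isClosed (hJ.isCompl_fundMinus hL) hL.isClosed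
    hJ.isClosed_fundMinus
  let Pp : H →L[ℂ] H := (2 : ℂ)⁻¹ • (1 + J)
  have hPp : ∀ x, Pp x = (2 : ℂ)⁻¹ • (x + J x) := fun x => by simp [Pp]
  let S : H →L[ℂ] H := L.projectionL (fundMinus J) hC
  let K : H →L[ℂ] H := S * Pp - Pp
  have hK : ∀ x, K x = S (Pp x) - Pp x := fun x => rfl
  have hPJ : ∀ x, Pp (J x) = Pp x := fun x => by rw [hPp, hPp, hJ.apply_apply, add_comm]
  have hKl : ∀ x, J (K x) = -K x := by
    intro x
    have h1 := Submodule.sub_projection_mem hC.isCompl (Pp x)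
    rw [hJ.mem_fundMinus] at h1
    have h2 : K x = -(Pp x - L.projection (fundMinus J) hC.isCompl (Pp x)) := by
      rw [neg_sub]; rfl
    rw [h2, map_neg, h1]
  have hKr : ∀ x, K (J x) = K x := fun x => by rw [hK, hK, hPJ]
  obtain ⟨hKal, hKar⟩ := hJ.adjoint_symmetry hKl hKr
  have hmem : ∀ x, Pp x + K x ∈ L := by
    intro x
    rw [hK, add_sub_cancel]
    exact Submodule.projection_apply_mem hC.isCompl _
  have hKP : ∀ x, K (Pp x) = K x := by
    intro x
    rw [hPp, map_smul, map_add, hKr]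
    module
  clear_value K
  have hKc : ∀ x, J x = x → x ≠ 0 → ‖K x‖ < ‖x‖ := by
    intro x hx h0
    have hP : Pp x = x := by rw [hPp, hx]; module
    have h1 := hJ.re_indefInner_add hx (hKl x)
    have h2 := hmem x
    rw [hP] at h2
    have h3 : x + K x ≠ 0 := by
      intro h
      have h4 : J (x + K x) = 0 := by rw [h, map_zero]
      rw [map_add, hx, hKl] at h4
      apply h0
      linear_combination (norm := module) (2 : ℂ)⁻¹ • h + (2 : ℂ)⁻¹ • h4
    have h5 := hL.isPositive _ h2 h3
    rw [h1] at h5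
    exact lt_of_pow_lt_pow_left₀ 2 (norm_nonneg _) (by linarith)
  -- Strictness passes to the adjoint through `‖K*x‖² = (KK*x, x) ≤ ‖KK*x‖ ‖x‖`, because `K*x` lies
  -- in `H₊`, where `K` is strict.
  have hKac : ∀ x, x ≠ 0 → ‖K.adjoint x‖ < ‖x‖ := by
    intro x h0
    rcases eq_or_ne (K.adjoint x) 0 with h | h
    · rw [h, norm_zero]
      exact norm_pos_iff.2 h0
    · have h1 := hKc _ (hKal x) h
      have h2 : ‖K.adjoint x‖ ^ 2 ≤ ‖K (K.adjoint x)‖ * ‖x‖ := by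
        rw [norm_sq_eq_re_inner (𝕜 := ℂ), ContinuousLinearMap.adjoint_inner_right]
        exact re_inner_le_norm _ _
      have h3 := norm_pos_iff.2 h
      have h4 := norm_pos_iff.2 h0
      nlinarith
  let T := K + K.adjoint
  have hTs : IsSelfAdjoint T := by
    rw [isSelfAdjoint_iff, star_add, ContinuousLinearMap.star_eq_adjoint,
      ContinuousLinearMap.star_eq_adjoint, ContinuousLinearMap.adjoint_adjoint, add_comm]
  have hT : ∀ x, T x = K x + K.adjoint x := fun x => rfl
  have hTa : ∀ x, J (T x) = -T (J x) := by
    intro x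
    rw [hT, hT, map_add, hKl, hKal, hKr, hKar]
    abel
  -- For `x = a + b` along `H₊ ⊕ H₋` the vectors `Ka` and `K*b` are orthogonal, so the squared norms
  -- of both sides add componentwise.
  have hTc : ∀ x, x ≠ 0 → ‖T x‖ < ‖x‖ := by
    intro x h0
    have e := hJ.norm_add_sq (hJ.half_add_mem x) (hJ.half_sub_mem x)
    rw [half_add_half] at e
    set a := (2 : ℂ)⁻¹ • (x + J x) with ha
    set b := (2 : ℂ)⁻¹ • (x - J x) with hb
    have hab : a + b = x := half_add_half x (J x)
    have hJa : J a = a := hJ.half_add_mem x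
    have hJb : J b = -b := hJ.half_sub_mem x
    have hKx : K x = K a := by rw [← hKP x, hPp]
    have hKx' : K.adjoint x = K.adjoint b := by
      rw [hb, map_smul, map_sub, hKar]
      module
    have e2 := hJ.norm_add_sq (hKal x) (hKl x)
    rw [add_comm, ← hT, hKx, hKx'] at e2
    have ea : ‖K a‖ ≤ ‖a‖ ∧ (a ≠ 0 → ‖K a‖ < ‖a‖) := by
      refine ⟨?_, hKc a hJa⟩
      rcases eq_or_ne a 0 with h | h
      · simp [h]
      · exact (hKc a hJa h).le
    have eb : ‖K.adjoint b‖ ≤ ‖b‖ ∧ (b ≠ 0 → ‖K.adjoint b‖ < ‖b‖) := by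
      refine ⟨?_, hKac b⟩
      rcases eq_or_ne b 0 with h | h
      · simp [h]
      · exact (hKac b h).le
    refine lt_of_pow_lt_pow_left₀ 2 (norm_nonneg _) ?_
    rw [e, e2]
    have ea2 := pow_le_pow_left₀ (norm_nonneg _) ea.1 2
    have eb2 := pow_le_pow_left₀ (norm_nonneg _) eb.1 2
    rcases eq_or_ne a 0 with h | h
    · have hb0 : b ≠ 0 := fun hb0 => h0 (by rw [← hab, h, hb0, add_zero])
      have := pow_lt_pow_left₀ (eb.2 hb0) (norm_nonneg _) two_ne_zero
      linarith
    · have := pow_lt_pow_left₀ (ea.2 h) (norm_nonneg _) two_ne_zero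
      linarith
  have hLe : L = image (1 + T) (fundPlus J) := by
    have hTp : ∀ x, J x = x → T x = K x := by
      intro x hx
      have := hKar x
      rw [hx] at this
      rw [hT]
      linear_combination (norm := module) (2 : ℂ)⁻¹ • this
    ext f
    rw [mem_image]
    constructor
    · intro hf
      refine ⟨Pp f, hJ.mem_fundPlus.2 ?_, ?_⟩
      · rw [hPp, hJ.half_add_mem]
      · have h1 : S f = f := Submodule.projection_apply_of_mem_left hC.isCompl hf
        have h2 : S (f - Pp f) = 0 := by
          refine (Submodule.projection_apply_eq_zero_iff hC.isCompl).2 (hJ.mem_fundMinus.2 ?_)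
          rw [hPp, map_sub, hJ.half_add_mem]
          module
        rw [map_sub, sub_eq_zero, h1] at h2
        have h3 : J (Pp f) = Pp f := by rw [hPp, hJ.half_add_mem]
        rw [add_apply, hTp _ h3, hKP, hK, ← h2, one_apply_eq_self]
        abel
    · rintro ⟨x, hx, rfl⟩
      rw [hJ.mem_fundPlus] at hx
      have hP : Pp x = x := by rw [hPp, hx]; module
      have := hmem x
      rw [hP] at this
      rwa [add_apply, hTp x hx]
  refine ⟨T, hTs, hTc, ?_, hLe, ?_⟩
  · ext x
    simpa using hTa x
  · rw [← hJ.indefOrthogonal_image_fundPlus hTs hTa, ← hLe]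

end IsFundamentalSymmetry

end Transition

/-! ### The operator of a direct sum and its adjoint -/

theorem IsPositive.disjoint_indefOrthogonal {J : H →L[ℂ] H} {L : Submodule ℂ H}
    (hL : IsPositive J L) : Disjoint L (indefOrthogonal J L) := by
  rw [Submodule.disjoint_def]
  intro x hx hx2
  by_contra h0
  have h1 := hL x hx h0
  have h2 : indefInner J x x = 0 := hx2 x hx
  simp [h2] at h1

/-- Disjointness makes the set of pairs single-valued, which is what `toLinearPMap` needs in order
to have that set as its graph. -/
theorem mem_graph_directSumOperator {Lp Lm : Submodule ℂ H} (h : Disjoint Lp Lm) {z : H × H} :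
    z ∈ (directSumOperator Lp Lm).graph ↔ ∃ a ∈ Lp, ∃ b ∈ Lm, z = (a + b, a - b) := by
  have hm : ∀ z : H × H, z ∈ (Lp.prod Lm).map
      ((LinearMap.fst ℂ H H + LinearMap.snd ℂ H H).prod
        (LinearMap.fst ℂ H H - LinearMap.snd ℂ H H)) ↔
      ∃ a ∈ Lp, ∃ b ∈ Lm, z = (a + b, a - b) := by
    intro z
    simp only [Submodule.mem_map, Prod.exists, Submodule.mem_prod]
    constructor
    · rintro ⟨a, b, ⟨ha, hb⟩, rfl⟩
      exact ⟨a, ha, b, hb, rfl⟩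
    · rintro ⟨a, ha, b, hb, rfl⟩
      exact ⟨a, b, ⟨ha, hb⟩, rfl⟩
  rw [directSumOperator, Submodule.toLinearPMap_graph_eq, hm]
  intro x hx hx0
  obtain ⟨a, ha, b, hb, rfl⟩ := (hm x).1 hx
  have hab : a = -b := eq_neg_of_add_eq_zero_left hx0
  have ha0 : a = 0 := (Submodule.disjoint_def.1 h) a ha (hab ▸ Lm.neg_mem hb)
  have hb0 : b = 0 := by rw [ha0] at hab; exact neg_eq_zero.1 hab.symm
  simp [ha0, hb0]

section DirectSum

variable [CompleteSpace H] {J : H →L[ℂ] H}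

omit [CompleteSpace H] in
theorem IsDirectSumPair.disjoint {Lp Lm : Submodule ℂ H} (h : IsDirectSumPair J Lp Lm) :
    Disjoint Lp Lm := by
  rw [h.eq_orthogonal]
  exact h.maximalPositive.isPositive.disjoint_indefOrthogonal

namespace IsTransitionOperator

variable {T : H →L[ℂ] H} {Lp Lm : Submodule ℂ H}

theorem apply_eq_neg (hT : IsTransitionOperator J T Lp Lm) (x : H) : J (T x) = -T (J x) :=
  congrArg (fun A : H →L[ℂ] H => A x) hT.anticommute

theorem inner_left (hT : IsTransitionOperator J T Lp Lm) (x y : H) :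
    ⟪T x, y⟫_ℂ = ⟪x, T y⟫_ℂ :=
  (ContinuousLinearMap.isSelfAdjoint_iff_isSymmetric.1 hT.isSelfAdjoint) x y

/-- The parameter `x` is the sum of the `H₊`- and `H₋`-vectors that `I + T` sends to the two
summands. Changing the sign of the second summand replaces `x` by `Jx`. -/
theorem mem_graph (hT : IsTransitionOperator J T Lp Lm) (hJ : IsFundamentalSymmetry J)
    (hd : Disjoint Lp Lm) {z : H × H} :
    z ∈ (directSumOperator Lp Lm).graph ↔ ∃ x, z = (x + T x, J x + T (J x)) := by
  rw [mem_graph_directSumOperator hd]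
  constructor
  · rintro ⟨a, ha, b, hb, rfl⟩
    rw [hT.plus_eq] at ha
    rw [hT.minus_eq] at hb
    obtain ⟨x, hx, rfl⟩ := mem_image.1 ha
    obtain ⟨y, hy, rfl⟩ := mem_image.1 hb
    rw [hJ.mem_fundPlus] at hx
    rw [hJ.mem_fundMinus] at hy
    refine ⟨x + y, ?_⟩
    simp only [add_apply, one_apply_eq_self, map_add, hx, hy, map_neg, Prod.mk.injEq]
    constructor <;> abel
  · rintro ⟨x, rfl⟩
    refine ⟨(1 + T) ((2 : ℂ)⁻¹ • (x + J x)), ?_, (1 + T) ((2 : ℂ)⁻¹ • (x - J x)), ?_, ?_⟩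
    · rw [hT.plus_eq]
      exact mem_image.2 ⟨_, hJ.mem_fundPlus.2 (hJ.half_add_mem x), rfl⟩
    · rw [hT.minus_eq]
      exact mem_image.2 ⟨_, hJ.mem_fundMinus.2 (hJ.half_sub_mem x), rfl⟩
    · simp only [add_apply, one_apply_eq_self, map_add, map_sub, map_smul, Prod.mk.injEq]
      constructor <;> module

/-- A vector orthogonal to the range of `I + T` satisfies `Ty = -y`, which strict contraction
forbids unless `y = 0`. -/
theorem dense_domain (hT : IsTransitionOperator J T Lp Lm) (hJ : IsFundamentalSymmetry J)
    (hd : Disjoint Lp Lm) : Dense ((directSumOperator Lp Lm).domain : Set H) := by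
  rw [Submodule.dense_iff_topologicalClosure_eq_top, Submodule.topologicalClosure_eq_top_iff,
    Submodule.eq_bot_iff]
  intro y hy
  rw [Submodule.mem_orthogonal] at hy
  by_contra h0
  have h1 : y + T y = 0 := by
    refine ext_inner_left ℂ fun x => ?_
    have hx : x + T x ∈ (directSumOperator Lp Lm).domain := by
      have := (hT.mem_graph hJ hd).2 ⟨x, rfl⟩
      rw [LinearPMap.mem_graph_iff] at this
      obtain ⟨u, hu, -⟩ := this
      have := u.2
      rwa [hu] at this
    have := hy _ hx
    rw [inner_add_left, hT.inner_left] at this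
    rw [inner_add_right, this, inner_zero_right]
  have h2 := hT.strong_contraction y h0
  rw [eq_neg_of_add_eq_zero_right h1, norm_neg] at h2
  exact lt_irrefl _ h2

theorem image (hT : IsTransitionOperator J T Lp Lm) (hJ : IsFundamentalSymmetry J) :
    IsTransitionOperator J (-T) (image J Lp) (image J Lm) where
  isSelfAdjoint := hT.isSelfAdjoint.neg
  strong_contraction f hf := by simpa using hT.strong_contraction f hf
  anticommute := by rw [mul_neg, neg_mul, hT.anticommute]
  plus_eq := by
    rw [hT.plus_eq, image_image]
    ext z
    simp only [mem_image]
    refine exists_congr fun y => and_congr_right fun hy => ?_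
    rw [hJ.mem_fundPlus] at hy
    simp [hy, hT.apply_eq_neg]
  minus_eq := by
    rw [hT.minus_eq, image_image]
    ext z
    simp only [mem_image]
    constructor
    · rintro ⟨y, hy, rfl⟩
      refine ⟨-y, Submodule.neg_mem _ hy, ?_⟩
      rw [hJ.mem_fundMinus] at hy
      simp [hy, hT.apply_eq_neg]
    · rintro ⟨y, hy, rfl⟩
      refine ⟨-y, Submodule.neg_mem _ hy, ?_⟩
      rw [hJ.mem_fundMinus] at hy
      simp [hy, hT.apply_eq_neg]

/-- For `x` in `H₊` the vector `x + Tx` has `H₊`-component `x`, so the equality of images forces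
equality of parameters. The same argument works on `H₋`. -/
theorem unique (hT : IsTransitionOperator J T Lp Lm) (hJ : IsFundamentalSymmetry J)
    {T' : H →L[ℂ] H} (hT' : IsTransitionOperator J T' Lp Lm) : T = T' := by
  have hp : ∀ x, J x = x → T x = T' x := by
    intro x hx
    have h1 : (1 + T) x ∈ Lp := by
      rw [hT.plus_eq]
      exact mem_image.2 ⟨x, hJ.mem_fundPlus.2 hx, rfl⟩
    rw [hT'.plus_eq] at h1
    obtain ⟨y, hy, e⟩ := mem_image.1 h1
    rw [hJ.mem_fundPlus] at hy
    simp only [add_apply, one_apply_eq_self] at e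
    have e2 := congrArg J e
    rw [map_add, map_add, hT.apply_eq_neg, hT'.apply_eq_neg, hx, hy] at e2
    have hxy : y = x := by
      linear_combination (norm := module) (2 : ℂ)⁻¹ • e + (2 : ℂ)⁻¹ • e2
    rw [hxy] at e
    exact (add_left_cancel e).symm
  have hm : ∀ x, J x = -x → T x = T' x := by
    intro x hx
    have h1 : (1 + T) x ∈ Lm := by
      rw [hT.minus_eq]
      exact mem_image.2 ⟨x, hJ.mem_fundMinus.2 hx, rfl⟩
    rw [hT'.minus_eq] at h1
    obtain ⟨y, hy, e⟩ := mem_image.1 h1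
    rw [hJ.mem_fundMinus] at hy
    simp only [add_apply, one_apply_eq_self] at e
    have e2 := congrArg J e
    rw [map_add, map_add, hT.apply_eq_neg, hT'.apply_eq_neg, hx, hy, map_neg, map_neg] at e2
    have hxy : y = x := by
      linear_combination (norm := module) (2 : ℂ)⁻¹ • e - (2 : ℂ)⁻¹ • e2
    rw [hxy] at e
    exact (add_left_cancel e).symm
  ext x
  rw [← half_add_half x (J x), map_add, map_add, hp _ (hJ.half_add_mem x),
    hm _ (hJ.half_sub_mem x)]

theorem isMaximalNegative (hT : IsTransitionOperator J T Lp Lm) (hJ : IsFundamentalSymmetry J)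
    (hc : IsClosed (Lm : Set H)) : IsMaximalNegative J Lm := by
  refine hJ.isMaximalNegative_of_surj hc ?_ fun h hh => ⟨(1 + T) h, ?_, ?_⟩
  · rw [hT.minus_eq]
    exact hJ.isNegative_image_fundMinus hT.apply_eq_neg hT.strong_contraction
  · rw [hT.minus_eq]
    exact mem_image.2 ⟨h, hJ.mem_fundMinus.2 hh, rfl⟩
  · simp only [add_apply, one_apply_eq_self, map_add, hT.apply_eq_neg, hh, map_neg]
    module

/-- The adjoint of the operator of a direct sum is the operator of the dual direct sum. -/
theorem adjoint_directSumOperator (hT : IsTransitionOperator J T Lp Lm)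
    (hJ : IsFundamentalSymmetry J) (hd : Disjoint Lp Lm)
    (hd' : Disjoint (Krein.image J Lp) (Krein.image J Lm)) :
    (directSumOperator Lp Lm)† = directSumOperator (Krein.image J Lp) (Krein.image J Lm) := by
  apply LinearPMap.eq_of_eq_graph
  rw [LinearPMap.adjoint_graph_eq_graph_adjoint (hT.dense_domain hJ hd)]
  ext ⟨y, z⟩
  rw [(hT.image hJ).mem_graph hJ hd', Submodule.mem_adjoint_iff]
  constructor
  · intro h
    -- The adjoint relation tested on the parametrized graph of the operator.
    have h1 : J y - T (J y) = z + T z := by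
      refine ext_inner_left ℂ fun x => ?_
      have h2 := h _ _ ((hT.mem_graph hJ hd).2 ⟨x, rfl⟩)
      simp only [inner_add_left, hT.inner_left, hJ.inner_left] at h2
      rw [hT.apply_eq_neg] at h2
      rw [inner_sub_right, inner_add_right]
      rw [inner_neg_right] at h2
      linear_combination h2
    have h2 := congrArg J h1
    simp only [map_sub, map_add, hT.apply_eq_neg, hJ.apply_apply] at h2
    -- If `y = (I - T)w` and `z = (I - T)Jw`, then `Jz = (I + T)w`, so `w` has to be the mean of `y`
    -- and `Jz`.
    refine ⟨(2 : ℂ)⁻¹ • (y + J z), ?_⟩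
    simp only [neg_apply, map_add, map_smul, hJ.apply_apply, Prod.mk.injEq]
    constructor
    · linear_combination (norm := module) (2 : ℂ)⁻¹ • h2
    · linear_combination (norm := module) -(2 : ℂ)⁻¹ • h1
  · rintro ⟨w, e⟩ a b hab
    obtain ⟨x, e2⟩ := (hT.mem_graph hJ hd).1 hab
    rw [Prod.mk.injEq] at e e2
    obtain ⟨rfl, rfl⟩ := e
    obtain ⟨rfl, rfl⟩ := e2
    simp only [neg_apply, inner_add_left, inner_add_right, inner_neg_right, hT.inner_left,
      hJ.inner_left, hT.apply_eq_neg]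
    simp only [map_neg, inner_neg_right]
    ring

end IsTransitionOperator

theorem IsDirectSumPair.exists_transition {Lp Lm : Submodule ℂ H} (h : IsDirectSumPair J Lp Lm)
    (hJ : IsFundamentalSymmetry J) : ∃ T, IsTransitionOperator J T Lp Lm := by
  rw [h.eq_orthogonal]
  exact hJ.exists_transition h.maximalPositive

theorem IsDirectSumPair.adjoint_eq {Lp Lm : Submodule ℂ H} (h : IsDirectSumPair J Lp Lm)
    (hJ : IsFundamentalSymmetry J) :
    (directSumOperator Lp Lm)† = directSumOperator (image J Lp) (image J Lm) := by
  obtain ⟨T, hT⟩ := h.exists_transition hJ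
  exact hT.adjoint_directSumOperator hJ h.disjoint (hJ.isDirectSumPair_image h).disjoint

theorem IsDirectSumPair.isMaximalNegative {Lp Lm : Submodule ℂ H} (h : IsDirectSumPair J Lp Lm)
    (hJ : IsFundamentalSymmetry J) : IsMaximalNegative J Lm := by
  obtain ⟨T, hT⟩ := h.exists_transition hJ
  refine hT.isMaximalNegative hJ ?_
  rw [h.eq_orthogonal]
  exact isClosed_indefOrthogonal J Lp

theorem isTransitionOperator_neg_image_iff (hJ : IsFundamentalSymmetry J) {T : H →L[ℂ] H}
    {Lp Lm : Submodule ℂ H} : IsTransitionOperator J T Lp Lm ↔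
      IsTransitionOperator J (-T) (image J Lp) (image J Lm) := by
  refine ⟨fun h => h.image hJ, fun h => ?_⟩
  have := h.image hJ
  rwa [neg_neg, hJ.image_image_self, hJ.image_image_self] at this

end DirectSum

/-! ### Bounded functional calculus of a spectral measure -/

open MeasureTheory Filter
open scoped Topology BoundedContinuousFunction

/-- Bounded measurable functions `ℝ → ℂ`. -/
structure BddMeas (f : ℝ → ℂ) : Prop where
  measurable : Measurable f
  bounded : ∃ c, ∀ t, ‖f t‖ ≤ c

namespace BddMeas

variable {f g : ℝ → ℂ}

theorem integrable (hf : BddMeas f) (μ : Measure ℝ) [IsFiniteMeasure μ] : Integrable f μ := by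
  obtain ⟨c, hc⟩ := hf.bounded
  exact Integrable.of_bound hf.measurable.aestronglyMeasurable c (Eventually.of_forall hc)

theorem add (hf : BddMeas f) (hg : BddMeas g) : BddMeas (f + g) := by
  obtain ⟨c, hc⟩ := hf.bounded
  obtain ⟨d, hd⟩ := hg.bounded
  exact ⟨hf.measurable.add hg.measurable, c + d, fun t =>
    (norm_add_le _ _).trans (add_le_add (hc t) (hd t))⟩

theorem mul (hf : BddMeas f) (hg : BddMeas g) : BddMeas (f * g) := by
  obtain ⟨c, hc⟩ := hf.bounded
  obtain ⟨d, hd⟩ := hg.bounded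
  refine ⟨hf.measurable.mul hg.measurable, c * d, fun t => ?_⟩
  rw [Pi.mul_apply, norm_mul]
  exact mul_le_mul (hc t) (hd t) (norm_nonneg _) ((norm_nonneg _).trans (hc t))

theorem star (hf : BddMeas f) : BddMeas (star f) := by
  obtain ⟨c, hc⟩ := hf.bounded
  refine ⟨continuous_star.measurable.comp hf.measurable, c, fun t => ?_⟩
  rw [Pi.star_apply, norm_star]
  exact hc t

theorem const (c : ℂ) : BddMeas fun _ => c := ⟨measurable_const, ‖c‖, fun _ => le_rfl⟩

theorem indicator_const {S : Set ℝ} (hS : MeasurableSet S) (c : ℂ) :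
    BddMeas (S.indicator fun _ => c) := by
  refine ⟨measurable_const.indicator hS, ‖c‖, fun t => ?_⟩
  exact norm_indicator_le_norm_self (fun _ => c) t

theorem comp (hf : BddMeas f) {φ : ℝ → ℝ} (hφ : Measurable φ) : BddMeas (f ∘ φ) := by
  obtain ⟨c, hc⟩ := hf.bounded
  exact ⟨hf.measurable.comp hφ, c, fun t => hc _⟩

theorem simpleFunc (s : SimpleFunc ℝ ℂ) : BddMeas s := by
  obtain ⟨c, hc⟩ := s.exists_forall_norm_le
  exact ⟨s.measurable, c, hc⟩

/-- Bounded measurable functions are uniform limits of simple functions. -/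
theorem exists_simpleFunc (hf : BddMeas f) {ε : ℝ} (hε : 0 < ε) :
    ∃ s : SimpleFunc ℝ ℂ, ∀ t, ‖s t - f t‖ < ε := by
  obtain ⟨c, hc⟩ := hf.bounded
  let e := TopologicalSpace.denseSeq ℂ
  -- Compactness of a disc containing the range leaves finitely many centres; rounding `f` to the
  -- nearest of them gives the simple function.
  have hcov : Metric.closedBall (0 : ℂ) c ⊆ ⋃ n, Metric.ball (e n) ε := by
    intro z _
    obtain ⟨n, hn⟩ := (TopologicalSpace.denseRange_denseSeq ℂ).exists_dist_lt z hε
    exact Set.mem_iUnion.2 ⟨n, hn⟩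
  obtain ⟨F, hF⟩ := (isCompact_closedBall (0 : ℂ) c).elim_finite_subcover _
    (fun n => Metric.isOpen_ball) hcov
  refine ⟨(SimpleFunc.nearestPt e (F.sup id)).comp f hf.measurable, fun t => ?_⟩
  have h1 := hF (mem_closedBall_zero_iff.2 (hc t))
  simp only [Set.mem_iUnion, Metric.mem_ball] at h1
  obtain ⟨n, hn, hd⟩ := h1
  have h2 := SimpleFunc.edist_nearestPt_le e (f t) (Finset.le_sup (f := id) hn)
  have h3 : edist (e n) (f t) < ENNReal.ofReal ε := by
    rw [edist_comm, edist_dist]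
    exact (ENNReal.ofReal_lt_ofReal_iff hε).2 hd
  have h4 := h2.trans_lt h3
  rw [edist_dist, ENNReal.ofReal_lt_ofReal_iff hε, dist_eq_norm] at h4
  exact h4

end BddMeas

namespace SpectralMeasure

variable [CompleteSpace H] (E : SpectralMeasure H)

theorem scalar_apply (x : H) {S : Set ℝ} (hS : MeasurableSet S) :
    E.scalar x S = ENNReal.ofReal (⟪x, E.proj S x⟫_ℂ).re :=
  Measure.ofMeasurable_apply S hS

instance (x : H) : IsFiniteMeasure (E.scalar x) :=
  ⟨by rw [E.scalar_apply x MeasurableSet.univ]; exact ENNReal.ofReal_lt_top⟩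

theorem inner_proj_left {S : Set ℝ} (hS : MeasurableSet S) (x y : H) :
    ⟪E.proj S x, y⟫_ℂ = ⟪x, E.proj S y⟫_ℂ :=
  (ContinuousLinearMap.isSelfAdjoint_iff_isSymmetric.1 (E.isSelfAdjoint S hS)) x y

theorem inner_proj_eq (x : H) {S : Set ℝ} (hS : MeasurableSet S) :
    ⟪x, E.proj S x⟫_ℂ = ((E.scalar x).real S : ℂ) := by
  rw [Measure.real, E.scalar_apply x hS, ENNReal.toReal_ofReal (E.re_inner_nonneg x hS)]
  refine Complex.ext (by simp) ?_
  have h := inner_conj_symm (𝕜 := ℂ) x (E.proj S x)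
  rw [E.inner_proj_left hS] at h
  simpa using Complex.conj_eq_iff_im.1 h

theorem proj_proj {S T : Set ℝ} (hS : MeasurableSet S) (hT : MeasurableSet T) (x : H) :
    E.proj S (E.proj T x) = E.proj (S ∩ T) x := by
  rw [E.proj_inter S T hS hT]
  rfl

theorem scalar_proj (x : H) {S : Set ℝ} (hS : MeasurableSet S) :
    E.scalar (E.proj S x) = (E.scalar x).restrict S := by
  ext T hT
  rw [Measure.restrict_apply hT, E.scalar_apply _ hT, E.scalar_apply _ (hT.inter hS),
    E.inner_proj_left hS, E.proj_proj hT hS, E.proj_proj hS (hT.inter hS)]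
  rw [Set.inter_eq_right.2 Set.inter_subset_right]

/-- `B = ∫ f dE` for a bounded function `f`. -/
def HasIntegral (f : ℝ → ℂ) (B : H →L[ℂ] H) : Prop :=
  ∀ x : H, ⟪x, B x⟫_ℂ = ∫ t, f t ∂(E.scalar x)

variable {E}

-- By complex polarization the quadratic form determines the operator, so `HasIntegral` can be
-- stated on the diagonal alone.
omit [CompleteSpace H] in
theorem _root_.Krein.ext_inner_self {A B : H →L[ℂ] H} (h : ∀ x, ⟪x, A x⟫_ℂ = ⟪x, B x⟫_ℂ) :
    A = B := by
  have := (ext_inner_map (A : H →ₗ[ℂ] H) B).1 fun x => by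
    have := congrArg (starRingEnd ℂ) (h x)
    rwa [inner_conj_symm, inner_conj_symm] at this
  ext x
  exact congrArg (fun T : H →ₗ[ℂ] H => T x) this

namespace HasIntegral

variable {f g : ℝ → ℂ} {A B : H →L[ℂ] H}

theorem unique (hA : E.HasIntegral f A) (hB : E.HasIntegral f B) : A = B :=
  ext_inner_self fun x => (hA x).trans (hB x).symm

theorem add (hA : E.HasIntegral f A) (hB : E.HasIntegral g B) (hf : BddMeas f)
    (hg : BddMeas g) : E.HasIntegral (f + g) (A + B) := by
  intro x
  rw [add_apply, inner_add_right, hA x, hB x, ← integral_add (hf.integrable _) (hg.integrable _)]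
  rfl

theorem sub (hA : E.HasIntegral f A) (hB : E.HasIntegral g B) (hf : BddMeas f)
    (hg : BddMeas g) : E.HasIntegral (f - g) (A - B) := by
  intro x
  rw [sub_apply, inner_sub_right, hA x, hB x, ← integral_sub (hf.integrable _) (hg.integrable _)]
  rfl

theorem star (hA : E.HasIntegral f A) : E.HasIntegral (star f) (star A) := by
  intro x
  rw [ContinuousLinearMap.star_eq_adjoint, ContinuousLinearMap.adjoint_inner_right,
    ← inner_conj_symm, hA x, ← integral_conj]
  rfl

theorem indicator (E : SpectralMeasure H) {S : Set ℝ} (hS : MeasurableSet S) (c : ℂ) :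
    E.HasIntegral (S.indicator fun _ => c) (c • E.proj S) := by
  intro x
  rw [smul_apply, inner_smul_right, E.inner_proj_eq x hS, integral_indicator_const _ hS]
  simp [mul_comm]

theorem piecewise (E : SpectralMeasure H) {S : Set ℝ} (hS : MeasurableSet S) (c : ℂ) :
    E.HasIntegral (SimpleFunc.piecewise S hS (SimpleFunc.const ℝ c) (SimpleFunc.const ℝ 0))
      (c • E.proj S) := by
  convert indicator E hS c using 1
  ext t
  by_cases h : t ∈ S <;> simp [h, Set.piecewise]

theorem exists_simpleFunc (E : SpectralMeasure H) (s : SimpleFunc ℝ ℂ) :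
    ∃ B, E.HasIntegral s B := by
  induction s using SimpleFunc.induction with
  | @const c S hS => exact ⟨_, piecewise E hS c⟩
  | @add s r _ hs hr =>
    obtain ⟨A, hA⟩ := hs
    obtain ⟨B, hB⟩ := hr
    exact ⟨_, hA.add hB (BddMeas.simpleFunc s) (BddMeas.simpleFunc r)⟩

/-- Bilinearity reduces the claim to indicators, where it is `E(S ∩ T) = E(S)E(T)`. -/
theorem mul_simpleFunc {s r : SimpleFunc ℝ ℂ} (hA : E.HasIntegral s A)
    (hB : E.HasIntegral r B) : E.HasIntegral (s * r : ℝ → ℂ) (A * B) := by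
  induction s using SimpleFunc.induction generalizing A with
  | @const c S hS =>
    induction r using SimpleFunc.induction generalizing B with
    | @const d T hT =>
      rw [hA.unique (piecewise E hS c), hB.unique (piecewise E hT d)]
      have := indicator E (hS.inter hT) (c * d)
      rw [E.proj_inter S T hS hT] at this
      convert this using 1
      · ext t
        by_cases h1 : t ∈ S <;> by_cases h2 : t ∈ T <;> simp [h1, h2]
      · rw [smul_mul_smul_comm]
    | @add s r _ hs hr =>
      obtain ⟨B1, hB1⟩ := exists_simpleFunc E s
      obtain ⟨B2, hB2⟩ := exists_simpleFunc E r
      rw [hB.unique (hB1.add hB2 (BddMeas.simpleFunc s) (BddMeas.simpleFunc r)), mul_add,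
        SimpleFunc.coe_add, mul_add]
      exact (hs hB1).add (hr hB2) ((BddMeas.simpleFunc _).mul (BddMeas.simpleFunc _))
        ((BddMeas.simpleFunc _).mul (BddMeas.simpleFunc _))
  | @add s r' _ hs hr =>
    obtain ⟨B1, hB1⟩ := exists_simpleFunc E s
    obtain ⟨B2, hB2⟩ := exists_simpleFunc E r'
    rw [hA.unique (hB1.add hB2 (BddMeas.simpleFunc s) (BddMeas.simpleFunc r')), add_mul,
      SimpleFunc.coe_add, add_mul]
    exact (hs hB1).add (hr hB2) ((BddMeas.simpleFunc _).mul (BddMeas.simpleFunc _))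
      ((BddMeas.simpleFunc _).mul (BddMeas.simpleFunc _))

theorem _root_.Krein.SpectralMeasure.real_scalar_univ (E : SpectralMeasure H) (x : H) :
    (E.scalar x).real Set.univ = ‖x‖ ^ 2 := by
  have h := E.inner_proj_eq x MeasurableSet.univ
  rw [E.proj_univ, one_apply_eq_self] at h
  rw [norm_sq_eq_re_inner (𝕜 := ℂ), h]
  simp

/-- `‖Ax‖² = (A*Ax, x) = ∫ |f|² dμ_x`, and `μ_x` has total mass `‖x‖²`. -/
theorem norm_le_of_mul (hA : E.HasIntegral (Star.star f * f) (Star.star A * A))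
    {c : ℝ} (hc : 0 ≤ c) (h : ∀ t, ‖f t‖ ≤ c) : ‖A‖ ≤ c := by
  refine A.opNorm_le_bound hc fun x => ?_
  refine le_of_sq_le_sq ?_ (by positivity)
  have h1 := hA x
  rw [mul_apply_eq_comp, ContinuousLinearMap.star_eq_adjoint,
    ContinuousLinearMap.adjoint_inner_right] at h1
  have h2 : ‖A x‖ ^ 2 = ‖⟪A x, A x⟫_ℂ‖ := by
    rw [inner_self_eq_norm_sq_to_K]
    simp
  rw [h2, h1, mul_pow, ← E.real_scalar_univ x]
  refine norm_integral_le_of_norm_le_const (Eventually.of_forall fun t => ?_)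
  rw [Pi.mul_apply, Pi.star_apply, norm_mul, norm_star, sq]
  exact mul_le_mul (h t) (h t) (norm_nonneg _) hc

/-- Passing to bounded pointwise limits. -/
theorem of_tendsto {F : ℕ → ℝ → ℂ} {B : ℕ → H →L[ℂ] H} {A : H →L[ℂ] H} (c : ℝ)
    (hm : ∀ n, Measurable (F n)) (hF : ∀ n t, ‖F n t‖ ≤ c)
    (hl : ∀ t, Tendsto (fun n => F n t) atTop (𝓝 (f t)))
    (hB : ∀ n, E.HasIntegral (F n) (B n)) (hA : ∀ x, Tendsto (fun n => B n x) atTop (𝓝 (A x))) :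
    E.HasIntegral f A := by
  intro x
  have h1 : Tendsto (fun n => ⟪x, B n x⟫_ℂ) atTop (𝓝 ⟪x, A x⟫_ℂ) :=
    tendsto_const_nhds.inner (hA x)
  have h2 : Tendsto (fun n => ∫ t, F n t ∂(E.scalar x)) atTop (𝓝 (∫ t, f t ∂(E.scalar x))) :=
    tendsto_integral_of_dominated_convergence (fun _ => c)
      (fun n => (hm n).aestronglyMeasurable) (integrable_const c)
      (fun n => Eventually.of_forall (hF n)) (Eventually.of_forall hl)
  refine tendsto_nhds_unique h1 (h2.congr fun n => ((hB n) x).symm)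

/-- Approximation by simple functions, with norm convergence of the integrals. -/
theorem exists_approx (E : SpectralMeasure H) (hf : BddMeas f) :
    ∃ (s : ℕ → SimpleFunc ℝ ℂ) (B : ℕ → H →L[ℂ] H) (A : H →L[ℂ] H) (c : ℝ),
      (∀ n, E.HasIntegral (s n) (B n)) ∧ (∀ n t, ‖s n t‖ ≤ c) ∧
      (∀ t, Tendsto (fun n => s n t) atTop (𝓝 (f t))) ∧ Tendsto B atTop (𝓝 A) ∧
      E.HasIntegral f A := by
  have hpos : ∀ n : ℕ, (0 : ℝ) < 1 / ((n : ℝ) + 1) := fun n => Nat.one_div_pos_of_nat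
  choose s hs using fun n : ℕ => hf.exists_simpleFunc (hpos n)
  choose B hB using fun n => exists_simpleFunc E (s n)
  obtain ⟨c, hc⟩ := hf.bounded
  have hle : ∀ n : ℕ, 1 / ((n : ℝ) + 1) ≤ 1 := fun n => by
    rw [div_le_one (by positivity)]
    linarith [(Nat.cast_nonneg n : (0 : ℝ) ≤ n)]
  have hbd : ∀ n t, ‖s n t‖ ≤ c + 1 := by
    intro n t
    calc ‖s n t‖ = ‖f t + (s n t - f t)‖ := by rw [add_sub_cancel]
      _ ≤ ‖f t‖ + ‖s n t - f t‖ := norm_add_le _ _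
      _ ≤ c + 1 := add_le_add (hc t) ((hs n t).le.trans (hle n))
  have hlim : ∀ t, Tendsto (fun n => s n t) atTop (𝓝 (f t)) := by
    intro t
    rw [tendsto_iff_norm_sub_tendsto_zero]
    exact squeeze_zero (fun _ => norm_nonneg _) (fun n => (hs n t).le)
      tendsto_one_div_add_atTop_nhds_zero_nat
  -- The sup norm of `s n - s m` controls the operator norm of `B n - B m`, so uniform convergence
  -- of the simple functions makes the operators Cauchy.
  have hcau : CauchySeq B := by
    have h0 := tendsto_one_div_add_atTop_nhds_zero_nat (𝕜 := ℝ)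
    refine cauchySeq_of_le_tendsto_0 (fun N : ℕ => 1 / ((N : ℝ) + 1) + 1 / ((N : ℝ) + 1)) ?_
      (by simpa using h0.add h0)
    intro n m N hn hm
    rw [dist_eq_norm]
    have h1 : E.HasIntegral (s n - s m : SimpleFunc ℝ ℂ) (B n - B m) :=
      (hB n).sub (hB m) (BddMeas.simpleFunc _) (BddMeas.simpleFunc _)
    have h2 : E.HasIntegral (Star.star (s n - s m : SimpleFunc ℝ ℂ) : SimpleFunc ℝ ℂ)
      (Star.star (B n - B m)) := h1.star
    refine norm_le_of_mul (h2.mul_simpleFunc h1)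
      (by linarith [hpos N]) fun t => ?_
    have e : (s n - s m : SimpleFunc ℝ ℂ) t = (s n t - f t) - (s m t - f t) := by
      rw [SimpleFunc.coe_sub, Pi.sub_apply]
      ring
    rw [e]
    refine (norm_sub_le _ _).trans (add_le_add ((hs n t).le.trans ?_) ((hs m t).le.trans ?_))
    · exact one_div_le_one_div_of_le (by positivity) (by exact_mod_cast Nat.succ_le_succ hn)
    · exact one_div_le_one_div_of_le (by positivity) (by exact_mod_cast Nat.succ_le_succ hm)
  obtain ⟨A, hA⟩ := cauchySeq_tendsto_of_complete hcau
  refine ⟨s, B, A, c + 1, hB, hbd, hlim, hA, ?_⟩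
  exact of_tendsto (c + 1) (fun n => (s n).measurable) hbd hlim hB fun x =>
    ((ContinuousLinearMap.apply ℂ H x).continuous.tendsto A).comp hA

theorem mul (hA : E.HasIntegral f A) (hB : E.HasIntegral g B) (hf : BddMeas f)
    (hg : BddMeas g) : E.HasIntegral (f * g) (A * B) := by
  obtain ⟨s, A', A1, c, h1, h2, h3, h4, h5⟩ := exists_approx E hf
  obtain ⟨r, B', B1, d, k1, k2, k3, k4, k5⟩ := exists_approx E hg
  rw [hA.unique h5, hB.unique k5]
  refine of_tendsto (F := fun n => s n * r n) (B := fun n => A' n * B' n) (c * d)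
    (fun n => (s n).measurable.mul (r n).measurable) (fun n t => ?_)
    (fun t => (h3 t).mul (k3 t)) (fun n => (h1 n).mul_simpleFunc (k1 n)) fun x =>
    ((ContinuousLinearMap.apply ℂ H x).continuous.tendsto (A1 * B1)).comp (h4.mul k4)
  rw [Pi.mul_apply, norm_mul]
  exact mul_le_mul (h2 n t) (k2 n t) (norm_nonneg _) ((norm_nonneg _).trans (h2 n t))

end HasIntegral

end SpectralMeasure

/-- Polarization for a linear map into `H` defined on a subspace. -/
theorem four_mul_inner_eq {V : Submodule ℂ H} (S : V →ₗ[ℂ] H) (u v : V) :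
    4 * ⟪(v : H), S u⟫_ℂ =
      ⟪((u + v : V) : H), S (u + v)⟫_ℂ - ⟪((u - v : V) : H), S (u - v)⟫_ℂ +
      Complex.I * (⟪((u + Complex.I • v : V) : H), S (u + Complex.I • v)⟫_ℂ -
        ⟪((u - Complex.I • v : V) : H), S (u - Complex.I • v)⟫_ℂ) := by
  simp only [Submodule.coe_add, Submodule.coe_sub, Submodule.coe_smul, map_add, map_sub, map_smul,
    inner_add_left, inner_add_right, inner_sub_left, inner_sub_right, inner_smul_left,
    inner_smul_right, Complex.conj_I]
  linear_combination (2 * ⟪(v : H), S u⟫_ℂ - 2 * ⟪(u : H), S v⟫_ℂ) * Complex.I_mul_I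

theorem tendsto_inner_of_tendsto_inner_self {V : Submodule ℂ H} {S : ℕ → V →ₗ[ℂ] H}
    {A : V →ₗ[ℂ] H}
    (h : ∀ u : V, Tendsto (fun n => ⟪(u : H), S n u⟫_ℂ) atTop (𝓝 ⟪(u : H), A u⟫_ℂ)) (u v : V) :
    Tendsto (fun n => ⟪(v : H), S n u⟫_ℂ) atTop (𝓝 ⟪(v : H), A u⟫_ℂ) := by
  have e : ∀ B : V →ₗ[ℂ] H, ⟪(v : H), B u⟫_ℂ = (4 : ℂ)⁻¹ *
      (⟪((u + v : V) : H), B (u + v)⟫_ℂ - ⟪((u - v : V) : H), B (u - v)⟫_ℂ +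
      Complex.I * (⟪((u + Complex.I • v : V) : H), B (u + Complex.I • v)⟫_ℂ -
        ⟪((u - Complex.I • v : V) : H), B (u - Complex.I • v)⟫_ℂ)) := by
    intro B
    rw [← four_mul_inner_eq, inv_mul_cancel_left₀ (by norm_num : (4 : ℂ) ≠ 0)]
  simp only [e]
  exact (((h _).sub (h _)).add (((h _).sub (h _)).const_mul _)).const_mul _

/-- The interval `[-n, n]`. -/
def window (n : ℕ) : Set ℝ := Set.Icc (-(n : ℝ)) n

/-- The truncation of `f` to `[-n, n]`, with complex values. -/
def truncate (f : ℝ → ℝ) (n : ℕ) : ℝ → ℂ :=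
  (window n).indicator fun t => (f t : ℂ)

theorem measurableSet_window (n : ℕ) : MeasurableSet (window n) := measurableSet_Icc

theorem mem_window_of_le {t : ℝ} {n : ℕ} (h : |t| ≤ n) : t ∈ window n :=
  abs_le.1 h

theorem window_subset {m n : ℕ} (h : m ≤ n) : window m ⊆ window n := by
  have : (m : ℝ) ≤ n := by exact_mod_cast h
  exact Set.Icc_subset_Icc (by linarith) this

theorem bddMeas_truncate {f : ℝ → ℝ} (hf : Continuous f) (n : ℕ) : BddMeas (truncate f n) := by
  refine ⟨(Complex.measurable_ofReal.comp hf.measurable).indicator (measurableSet_window n), ?_⟩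
  obtain ⟨c, hc⟩ := (isCompact_Icc (a := -(n : ℝ)) (b := n)).exists_bound_of_continuousOn
    hf.continuousOn
  refine ⟨max c 0, fun t => ?_⟩
  by_cases h : t ∈ window n
  · rw [truncate, Set.indicator_of_mem h, Complex.norm_real]
    exact (hc t h).trans (le_max_left _ _)
  · rw [truncate, Set.indicator_of_notMem h, norm_zero]
    exact le_max_right _ _

theorem tendsto_truncate (f : ℝ → ℝ) (t : ℝ) :
    Tendsto (fun n => truncate f n t) atTop (𝓝 (f t : ℂ)) := by
  obtain ⟨N, hN⟩ := exists_nat_ge |t|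
  refine tendsto_const_nhds.congr' ?_
  filter_upwards [eventually_ge_atTop N] with n hn
  have : t ∈ window n := mem_window_of_le (hN.trans (by exact_mod_cast hn))
  rw [truncate, Set.indicator_of_mem this]

theorem norm_truncate_le (f : ℝ → ℝ) (n : ℕ) (t : ℝ) : ‖truncate f n t‖ ≤ |f t| := by
  refine (norm_indicator_le_norm_self _ t).trans ?_
  simp

/-! ### Unbounded integrals through truncation to windows -/

namespace SpectralMeasure

variable [CompleteSpace H] (E : SpectralMeasure H)

/-- The operator `∫ f dE` for a bounded measurable function `f`. -/
def integral (f : ℝ → ℂ) : H →L[ℂ] H :=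
  open Classical in if h : ∃ B, E.HasIntegral f B then h.choose else 0

variable {E} {f g : ℝ → ℂ}

theorem hasIntegral_integral (hf : BddMeas f) : E.HasIntegral f (E.integral f) := by
  have h : ∃ B, E.HasIntegral f B := by
    obtain ⟨_, _, A, _, _, _, _, _, h⟩ := HasIntegral.exists_approx E hf
    exact ⟨A, h⟩
  rw [integral, dif_pos h]
  exact h.choose_spec

theorem HasIntegral.integral_eq {B : H →L[ℂ] H} (hB : E.HasIntegral f B) (hf : BddMeas f) :
    E.integral f = B := (hasIntegral_integral hf).unique hB

theorem integral_mul (hf : BddMeas f) (hg : BddMeas g) (x : H) :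
    E.integral (f * g) x = E.integral f (E.integral g x) := by
  rw [((hasIntegral_integral hf).mul (hasIntegral_integral hg) hf hg).integral_eq (hf.mul hg)]
  rfl

theorem integral_add (hf : BddMeas f) (hg : BddMeas g) :
    E.integral (f + g) = E.integral f + E.integral g :=
  ((hasIntegral_integral hf).add (hasIntegral_integral hg) hf hg).integral_eq (hf.add hg)

theorem integral_star (hf : BddMeas f) : E.integral (star f) = star (E.integral f) :=
  ((hasIntegral_integral hf).star).integral_eq hf.star

theorem integral_indicator {S : Set ℝ} (hS : MeasurableSet S) :
    E.integral (S.indicator fun _ => 1) = E.proj S := by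
  have := HasIntegral.indicator E hS 1
  rw [one_smul] at this
  exact this.integral_eq (BddMeas.indicator_const hS 1)

theorem integral_const (c : ℂ) : E.integral (fun _ => c) = c • 1 := by
  have := HasIntegral.indicator E MeasurableSet.univ c
  rw [E.proj_univ, Set.indicator_univ] at this
  exact this.integral_eq (BddMeas.const c)

theorem norm_integral_sq (hf : BddMeas f) (x : H) :
    ‖E.integral f x‖ ^ 2 = ∫ t, ‖f t‖ ^ 2 ∂(E.scalar x) := by
  have h := (hasIntegral_integral (E := E) hf).star.mul (hasIntegral_integral hf) hf.star hf x
  rw [mul_apply_eq_comp, ContinuousLinearMap.star_eq_adjoint,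
    ContinuousLinearMap.adjoint_inner_right, inner_self_eq_norm_sq_to_K] at h
  have h2 : ∀ t, (star f * f) t = ((‖f t‖ ^ 2 : ℝ) : ℂ) := by
    intro t
    rw [Pi.mul_apply, Pi.star_apply]
    simpa using Complex.conj_mul' (f t)
  simp only [h2] at h
  rw [integral_complex_ofReal] at h
  refine Complex.ofReal_injective ?_
  rw [← h]
  simp

/-- The ranges of the spectral projections of bounded intervals are total. -/
theorem eq_of_proj_window_eq {x y : H} (h : ∀ n, E.proj (window n) x = E.proj (window n) y) :
    x = y := by
  have h0 : ∀ n, E.scalar (x - y) (window n) = 0 := by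
    intro n
    rw [E.scalar_apply _ (measurableSet_window n), map_sub, h n]
    simp
  have h1 : E.scalar (x - y) Set.univ = 0 := by
    have : (Set.univ : Set ℝ) = ⋃ n, window n := by
      refine (Set.eq_univ_of_forall fun t => ?_).symm
      obtain ⟨N, hN⟩ := exists_nat_ge |t|
      exact Set.mem_iUnion.2 ⟨N, mem_window_of_le hN⟩
    rw [this]
    exact measure_iUnion_null h0
  have h2 := E.real_scalar_univ (x - y)
  rw [Measure.real, h1] at h2
  simpa [sub_eq_zero] using h2.symm

theorem proj_integral {S : Set ℝ} (hS : MeasurableSet S) (hf : BddMeas f) (x : H) :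
    E.proj S (E.integral f x) = E.integral (S.indicator f) x := by
  rw [← integral_indicator hS, ← integral_mul (BddMeas.indicator_const hS 1) hf]
  congr 2
  ext t
  by_cases h : t ∈ S <;> simp [h]

namespace IsIntegral

variable {φ : ℝ → ℝ} {A : H →ₗ.[ℂ] H}

theorem integrable_one_add_sq (hA : E.IsIntegral φ A) (hφ : Continuous φ) (u : A.domain) :
    Integrable (fun t => 1 + φ t ^ 2) (E.scalar (u : H)) := by
  have hsq : Integrable (fun t => φ t ^ 2) (E.scalar (u : H)) := by
    refine ⟨(hφ.pow 2).aestronglyMeasurable, ?_⟩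
    rw [hasFiniteIntegral_iff_ofReal (Eventually.of_forall fun t => sq_nonneg _)]
    exact (hA.mem_domain_iff u).1 u.2
  exact (integrable_const 1).add hsq

theorem abs_le_one_add_sq (a : ℝ) : |a| ≤ 1 + a ^ 2 := by
  rw [← sq_abs]
  nlinarith [abs_nonneg a, sq_nonneg (|a| - 1)]

theorem integrable (hA : E.IsIntegral φ A) (hφ : Continuous φ) (u : A.domain) :
    Integrable φ (E.scalar (u : H)) :=
  (hA.integrable_one_add_sq hφ u).mono' hφ.aestronglyMeasurable
    (Eventually.of_forall fun t => abs_le_one_add_sq (φ t))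

theorem tendsto_inner_self (hA : E.IsIntegral φ A) (hφ : Continuous φ) (u : A.domain) :
    Tendsto (fun n => ⟪(u : H), E.integral (truncate φ n) (u : H)⟫_ℂ) atTop (𝓝 ⟪(u : H), A u⟫_ℂ) := by
  have h1 : ∀ n, ⟪(u : H), E.integral (truncate φ n) (u : H)⟫_ℂ
      = ∫ t, truncate φ n t ∂(E.scalar (u : H)) :=
    fun n => hasIntegral_integral (E := E) (bddMeas_truncate hφ n) (u : H)
  simp only [h1]
  rw [hA.inner_eq, ← integral_complex_ofReal]
  have hint := hA.integrable_one_add_sq hφ u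
  refine tendsto_integral_of_dominated_convergence (fun t => 1 + φ t ^ 2)
    (fun n => (bddMeas_truncate hφ n).measurable.aestronglyMeasurable) hint
    (fun n => Eventually.of_forall fun t => (norm_truncate_le φ n t).trans
      (abs_le_one_add_sq (φ t)))
    (Eventually.of_forall fun t => tendsto_truncate φ t)

theorem tendsto_inner (hA : E.IsIntegral φ A) (hφ : Continuous φ) (u v : A.domain) :
    Tendsto (fun n => ⟪(v : H), E.integral (truncate φ n) (u : H)⟫_ℂ) atTop (𝓝 ⟪(v : H), A u⟫_ℂ) :=
  tendsto_inner_of_tendsto_inner_self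
    (S := fun n => (E.integral (truncate φ n) : H →ₗ[ℂ] H).comp A.domain.subtype)
    (A := A.toFun) (hA.tendsto_inner_self hφ) u v

theorem inner_im (hA : E.IsIntegral φ A) (u : A.domain) : (⟪(u : H), A u⟫_ℂ).im = 0 := by
  rw [hA.inner_eq, Complex.ofReal_im]

/-- The truncations are real, so their integrals are self-adjoint; symmetry survives the weak limit.
-/
theorem symmetric (hA : E.IsIntegral φ A) (hφ : Continuous φ) (u v : A.domain) :
    ⟪(v : H), A u⟫_ℂ = ⟪A v, (u : H)⟫_ℂ := by
  have h1 := hA.tendsto_inner hφ u v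
  have h2 := (Complex.continuous_conj.tendsto _).comp (hA.tendsto_inner hφ v u)
  rw [inner_conj_symm] at h2
  refine tendsto_nhds_unique h1 (h2.congr fun n => ?_)
  have h3 : star (truncate φ n) = truncate φ n := by
    ext t
    by_cases h : t ∈ window n <;> simp [truncate, h]
  have h4 := integral_star (E := E) (bddMeas_truncate hφ n)
  rw [h3] at h4
  rw [Function.comp_apply, inner_conj_symm]
  nth_rewrite 1 [h4]
  rw [ContinuousLinearMap.star_eq_adjoint, ContinuousLinearMap.adjoint_inner_left]

theorem proj_window_mem (hA : E.IsIntegral φ A) (hφ : Continuous φ) (n : ℕ) (x : H) :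
    E.proj (window n) x ∈ A.domain := by
  rw [hA.mem_domain_iff, E.scalar_proj x (measurableSet_window n)]
  obtain ⟨c, hc⟩ := (isCompact_Icc (a := -(n : ℝ)) (b := n)).exists_bound_of_continuousOn
    (hφ.pow 2).continuousOn
  refine (setLIntegral_mono (g := fun _ => ENNReal.ofReal c) measurable_const
    fun t ht => ?_).trans_lt ?_
  · exact ENNReal.ofReal_le_ofReal ((le_abs_self _).trans (hc t ht))
  · rw [setLIntegral_const]
    exact ENNReal.mul_lt_top ENNReal.ofReal_lt_top (measure_lt_top _ _)

/-- Vectors `E(window m) z` lie in the domain. Paired with them, the truncated integrals of `φ` are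
constant in `n` once `n ≥ m`, so the weak limit is known. -/
theorem proj_window_apply (hA : E.IsIntegral φ A) (hφ : Continuous φ) (u : A.domain) (m : ℕ) :
    E.proj (window m) (A u) = E.integral (truncate φ m) u := by
  refine ext_inner_left ℂ fun z => ?_
  rw [← E.inner_proj_left (measurableSet_window m)]
  have h1 := hA.tendsto_inner hφ u ⟨_, hA.proj_window_mem hφ m z⟩
  refine tendsto_nhds_unique h1 (tendsto_const_nhds.congr' ?_)
  filter_upwards [eventually_ge_atTop m] with n hn
  rw [E.inner_proj_left (measurableSet_window m),
    proj_integral (measurableSet_window m) (bddMeas_truncate hφ n)]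
  congr 3
  ext t
  by_cases h : t ∈ window m
  · rw [Set.indicator_of_mem h, truncate, truncate, Set.indicator_of_mem h,
      Set.indicator_of_mem (window_subset hn h)]
  · rw [Set.indicator_of_notMem h, truncate, Set.indicator_of_notMem h]

/-- The graph of `∫ φ dE` in terms of bounded integrals. -/
theorem mem_graph_iff (hA : E.IsIntegral φ A) (hφ : Continuous φ) {x y : H} :
    (x, y) ∈ A.graph ↔ ∀ n, E.proj (window n) y = E.integral (truncate φ n) x := by
  constructor
  · intro h n
    obtain ⟨u, hu, hu2⟩ := (LinearPMap.mem_graph_iff A).1 h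
    simp only at hu hu2
    rw [← hu, ← hu2]
    exact hA.proj_window_apply hφ u n
  · intro h
    have hx : x ∈ A.domain := by
      rw [hA.mem_domain_iff]
      -- The truncated integrals of `φ²` equal `‖E(window n) y‖² ≤ ‖y‖²`, and they increase to the
      -- integral that decides membership in the domain.
      refine lt_of_le_of_lt ?_ (ENNReal.ofReal_lt_top (r := ‖y‖ ^ 2))
      have h1 : Tendsto (fun n => ∫⁻ t, ENNReal.ofReal (‖truncate φ n t‖ ^ 2) ∂(E.scalar x)) atTop
          (𝓝 (∫⁻ t, ENNReal.ofReal (φ t ^ 2) ∂(E.scalar x))) := by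
        refine lintegral_tendsto_of_tendsto_of_monotone (fun n => ?_)
          (Eventually.of_forall fun t m n hmn => ?_) (Eventually.of_forall fun t => ?_)
        · exact ((bddMeas_truncate hφ n).measurable.norm.pow_const 2).ennreal_ofReal.aemeasurable
        · refine ENNReal.ofReal_le_ofReal (pow_le_pow_left₀ (norm_nonneg _) ?_ 2)
          exact norm_indicator_le_of_subset (window_subset hmn) _ t
        · have := ((tendsto_truncate φ t).norm.pow 2)
          rw [Complex.norm_real, Real.norm_eq_abs, sq_abs] at this
          exact (ENNReal.continuous_ofReal.tendsto _).comp this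
      refine le_of_tendsto' h1 fun n => ?_
      have h2 := (bddMeas_truncate hφ n)
      have h3 : Integrable (fun t => ‖truncate φ n t‖ ^ 2) (E.scalar x) := by
        have := (h2.star.mul h2).integrable (E.scalar x)
        refine this.norm.congr (Eventually.of_forall fun t => ?_)
        simp [sq]
      rw [← ofReal_integral_eq_lintegral_ofReal h3 (Eventually.of_forall fun t => sq_nonneg _),
        ← norm_integral_sq h2, ← h n]
      refine ENNReal.ofReal_le_ofReal (pow_le_pow_left₀ (norm_nonneg _) ?_ 2)
      have h4 := norm_integral_sq (E := E) (BddMeas.indicator_const (measurableSet_window n) 1) y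
      rw [integral_indicator (measurableSet_window n)] at h4
      refine le_of_sq_le_sq ?_ (norm_nonneg _)
      rw [h4, ← E.real_scalar_univ y]
      have h5 : ∀ t, ‖(window n).indicator (fun _ => (1 : ℂ)) t‖ ^ 2 ≤ 1 := by
        intro t
        by_cases h : t ∈ window n <;> simp [h]
      have h6 := norm_integral_le_of_norm_le_const (μ := E.scalar y) (C := 1)
        (f := fun t => ‖(window n).indicator (fun _ => (1 : ℂ)) t‖ ^ 2)
        (Eventually.of_forall fun t => by simpa using h5 t)
      rw [one_mul] at h6
      exact (le_abs_self _).trans h6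
    have : A ⟨x, hx⟩ = y := eq_of_proj_window_eq (E := E) fun n => by
      rw [hA.proj_window_apply hφ, h n]
    exact (LinearPMap.mem_graph_iff A).2 ⟨⟨x, hx⟩, rfl, this⟩

end IsIntegral

end SpectralMeasure

/-! ### Uniqueness of the spectral measure, conjugation and reflection -/

namespace SpectralMeasure

variable [CompleteSpace H] {E F : SpectralMeasure H}

theorem sub_I_ne_zero (t : ℝ) : (t : ℂ) - Complex.I ≠ 0 := by
  intro h
  have := congrArg Complex.im h
  simp at this

/-- The function `t ↦ (t - i)⁻¹`. -/
def resolventFun : ℝ →ᵇ ℂ :=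
  BoundedContinuousFunction.ofNormedAddCommGroup (fun t : ℝ => ((t : ℂ) - Complex.I)⁻¹)
    (Continuous.inv₀ (by fun_prop) sub_I_ne_zero) 1
    (by
      intro t
      rw [norm_inv]
      refine inv_le_one_of_one_le₀ ?_
      have := Complex.abs_im_le_norm ((t : ℂ) - Complex.I)
      simpa using this)

theorem bddMeas_continuous (g : ℝ →ᵇ ℂ) : BddMeas g :=
  ⟨g.continuous.measurable, ‖g‖, g.norm_coe_le_norm⟩

/-- The operator form of `t(t - i)⁻¹ = 1 + i(t - i)⁻¹`, checked on each window. -/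
theorem mem_graph_resolvent {Q : H →ₗ.[ℂ] H} (hQ : E.IsIntegral (fun t => t) Q) (h : H) :
    (E.integral resolventFun h, h + Complex.I • E.integral resolventFun h) ∈ Q.graph := by
  have hr := bddMeas_continuous resolventFun
  rw [hQ.mem_graph_iff continuous_id']
  intro n
  rw [← integral_mul (bddMeas_truncate continuous_id' n) hr, map_add, map_smul,
    proj_integral (measurableSet_window n) hr, ← integral_indicator (measurableSet_window n)]
  have h1 := integral_const (E := E) Complex.I
  have h2 : ∀ z, Complex.I • z = E.integral (fun _ => Complex.I) z := fun z => by
    rw [h1]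
    rfl
  have hi : BddMeas ((window n).indicator resolventFun) := by
    have := (BddMeas.indicator_const (measurableSet_window n) 1).mul hr
    convert this using 1
    ext t
    by_cases h : t ∈ window n <;> simp [h]
  have hc := BddMeas.const Complex.I
  rw [h2, ← integral_mul hc hi, ← add_apply,
    ← integral_add (BddMeas.indicator_const (measurableSet_window n) 1) (hc.mul hi)]
  congr 2
  ext t
  by_cases ht : t ∈ window n
  · have := sub_I_ne_zero t
    simp only [Pi.add_apply, Pi.mul_apply, Set.indicator_of_mem ht, truncate, resolventFun,
      BoundedContinuousFunction.coe_ofNormedAddCommGroup]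
    field_simp
    ring
  · simp [ht, truncate]

/-- The difference `d` of the two values satisfies `Qd = id`. Since `(Qd, d)` is real, `d = 0`. -/
theorem integral_resolventFun_eq {Q : H →ₗ.[ℂ] H} (hE : E.IsIntegral (fun t => t) Q)
    (hF : F.IsIntegral (fun t => t) Q) : E.integral resolventFun = F.integral resolventFun := by
  ext h
  have h1 := Q.graph.sub_mem (mem_graph_resolvent hE h) (mem_graph_resolvent hF h)
  rw [Prod.mk_sub_mk, add_sub_add_left_eq_sub, ← smul_sub] at h1
  obtain ⟨u, hu, hu2⟩ := (LinearPMap.mem_graph_iff Q).1 h1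
  have h2 := hE.inner_im u
  simp only at hu hu2
  rw [hu2, ← hu, inner_smul_right, inner_self_eq_norm_sq_to_K] at h2
  rw [← sub_eq_zero, ← hu]
  have h3 : (Complex.I * ((‖(u : H)‖ : ℝ) : ℂ) ^ 2).im = 0 := h2
  rw [← Complex.ofReal_pow, Complex.I_mul_im, Complex.ofReal_re] at h3
  simpa using h3

/-- The bounded continuous functions with the same integral for two spectral measures. -/
def agreeing (E F : SpectralMeasure H) : StarSubalgebra ℂ (ℝ →ᵇ ℂ) where
  carrier := {g | E.integral g = F.integral g}
  mul_mem' := by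
    intro f g hf hg
    ext x
    change E.integral (f * g : ℝ → ℂ) x = F.integral (f * g : ℝ → ℂ) x
    rw [integral_mul (bddMeas_continuous f) (bddMeas_continuous g),
      integral_mul (bddMeas_continuous f) (bddMeas_continuous g),
      show E.integral f = F.integral f from hf, show E.integral g = F.integral g from hg]
  add_mem' := by
    intro f g hf hg
    change E.integral (f + g : ℝ → ℂ) = F.integral (f + g : ℝ → ℂ)
    rw [integral_add (bddMeas_continuous f) (bddMeas_continuous g),
      integral_add (bddMeas_continuous f) (bddMeas_continuous g),
      show E.integral f = F.integral f from hf, show E.integral g = F.integral g from hg]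
  algebraMap_mem' := by
    intro c
    change E.integral (fun _ => algebraMap ℂ ℂ c) = F.integral (fun _ => algebraMap ℂ ℂ c)
    rw [integral_const, integral_const]
  star_mem' := by
    intro f hf
    change E.integral (star (f : ℝ → ℂ)) = F.integral (star (f : ℝ → ℂ))
    rw [integral_star (bddMeas_continuous f), integral_star (bddMeas_continuous f),
      show E.integral f = F.integral f from hf]

/-- The spectral measure of an operator is unique. -/
theorem scalar_eq_of_isIntegral {Q : H →ₗ.[ℂ] H} (hE : E.IsIntegral (fun t => t) Q)
    (hF : F.IsIntegral (fun t => t) Q) (x : H) : E.scalar x = F.scalar x := by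
  -- A star-subalgebra of bounded continuous functions that separates points determines a finite
  -- measure on `ℝ`. Here `resolventFun` alone separates points.
  refine ext_of_forall_mem_subalgebra_integral_eq_of_polish (𝕜 := ℂ) (A := agreeing E F) ?_ ?_
  · intro s t hst
    refine ⟨resolventFun, ⟨_, ⟨resolventFun, integral_resolventFun_eq hE hF, rfl⟩, rfl⟩, ?_⟩
    intro h
    apply hst
    have h1 : ((s : ℂ) - Complex.I)⁻¹ = ((t : ℂ) - Complex.I)⁻¹ := h
    simpa using h1
  · intro g hg
    have h1 : E.integral g = F.integral g := hg
    rw [← hasIntegral_integral (bddMeas_continuous g) x, h1,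
      hasIntegral_integral (bddMeas_continuous g) x]

/-- Conjugation of a spectral measure by a fundamental symmetry. -/
def conj (E : SpectralMeasure H) {J : H →L[ℂ] H} (hJ : IsFundamentalSymmetry J) :
    SpectralMeasure H where
  proj S := J * E.proj S * J
  isSelfAdjoint S hS := by
    rw [isSelfAdjoint_iff, star_mul, star_mul, hJ.isSelfAdjoint.star_eq,
      (E.isSelfAdjoint S hS).star_eq, mul_assoc]
  proj_univ := by rw [E.proj_univ, mul_one, hJ.sq_eq_one]
  proj_inter S T hS hT := by
    rw [E.proj_inter S T hS hT]
    calc J * (E.proj S * E.proj T) * J = J * E.proj S * 1 * E.proj T * J := by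
          simp only [mul_one, mul_assoc]
      _ = _ := by
          rw [← hJ.sq_eq_one]
          simp only [mul_assoc]
  hasSum S hS hd x := (E.hasSum S hS hd (J x)).mapL J

theorem scalar_conj {J : H →L[ℂ] H} (hJ : IsFundamentalSymmetry J) (x : H) :
    (E.conj hJ).scalar x = E.scalar (J x) := by
  ext S hS
  rw [scalar_apply _ _ hS, scalar_apply _ _ hS, hJ.inner_left]
  rfl

/-- The image of a spectral measure under `t ↦ -t`. -/
def reflect (E : SpectralMeasure H) : SpectralMeasure H where
  proj S := E.proj ((fun t => -t) ⁻¹' S)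
  isSelfAdjoint S hS := E.isSelfAdjoint _ (measurable_neg hS)
  proj_univ := by rw [Set.preimage_univ, E.proj_univ]
  proj_inter S T hS hT := by
    rw [Set.preimage_inter, E.proj_inter _ _ (measurable_neg hS) (measurable_neg hT)]
  hasSum S hS hd x := by
    rw [Set.preimage_iUnion]
    exact E.hasSum _ (fun i => measurable_neg (hS i)) (fun i j h => (hd h).preimage _) x

theorem scalar_reflect (x : H) :
    E.reflect.scalar x = (E.scalar x).map (fun t => -t) := by
  ext S hS
  rw [scalar_apply _ _ hS, Measure.map_apply measurable_neg hS,
    scalar_apply _ _ (measurable_neg hS)]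
  rfl

theorem IsIntegral.conj {J : H →L[ℂ] H} (hJ : IsFundamentalSymmetry J) {φ : ℝ → ℝ}
    {A A' : H →ₗ.[ℂ] H} (hA : E.IsIntegral φ A) (hd : ∀ x, x ∈ A'.domain ↔ J x ∈ A.domain)
    (he : ∀ x : A'.domain, A' x = J (A ⟨J x, (hd x).1 x.2⟩)) :
    (E.conj hJ).IsIntegral φ A' where
  mem_domain_iff x := by rw [hd, hA.mem_domain_iff, scalar_conj]
  inner_eq x := by
    rw [he, ← hJ.inner_left, scalar_conj]
    exact hA.inner_eq ⟨J x, (hd x).1 x.2⟩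

theorem IsIntegral.reflect_neg {Q : H →ₗ.[ℂ] H} (hQ : E.IsIntegral (fun t => t) (-Q)) :
    E.reflect.IsIntegral (fun t => t) Q where
  mem_domain_iff x := by
    rw [scalar_reflect, lintegral_map (by fun_prop) measurable_neg]
    simpa using hQ.mem_domain_iff x
  inner_eq x := by
    have := hQ.inner_eq x
    rw [LinearPMap.neg_apply, inner_neg_right] at this
    rw [scalar_reflect, integral_map measurable_neg.aemeasurable (by fun_prop),
      MeasureTheory.integral_neg, Complex.ofReal_neg, ← this, neg_neg]

section Anticommuting

variable {J : H →L[ℂ] H} {Q : H →ₗ.[ℂ] H}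

theorem isIntegral_conj_neg (hJ : IsFundamentalSymmetry J) (ha : Anticommutes J Q)
    (hE : E.IsIntegral (fun t => t) Q) : (E.conj hJ).IsIntegral (fun t => t) (-Q) := by
  refine hE.conj hJ (fun x => (ha.mem_domain_iff x).symm) fun x => ?_
  have h1 := ha.apply_eq x ((ha.mem_domain_iff x).2 x.2)
  rw [← hJ.apply_apply ((-Q) x), LinearPMap.neg_apply, map_neg]
  congr 1
  exact neg_eq_iff_eq_neg.2 h1

/-- Conjugating `E` by `J` represents `-Q`, and reflecting the result represents `Q` again;
uniqueness identifies its scalar measures with those of `E`. -/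
theorem scalar_apply_map_neg (hJ : IsFundamentalSymmetry J) (ha : Anticommutes J Q)
    (hE : E.IsIntegral (fun t => t) Q) (x : H) :
    (E.scalar (J x)).map (fun t => -t) = E.scalar x := by
  rw [← scalar_conj hJ, ← scalar_reflect]
  exact scalar_eq_of_isIntegral (isIntegral_conj_neg hJ ha hE).reflect_neg hE x

theorem integral_apply_symmetry (hJ : IsFundamentalSymmetry J) (ha : Anticommutes J Q)
    (hE : E.IsIntegral (fun t => t) Q) {f : ℝ → ℂ} (hf : BddMeas f) (x : H) :
    E.integral f (J x) = J (E.integral (fun t => f (-t)) x) := by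
  have hf' : BddMeas fun t => f (-t) := hf.comp measurable_neg
  have h : E.HasIntegral (fun t => f (-t)) (J * E.integral f * J) := by
    intro x
    rw [mul_apply_eq_comp, mul_apply_eq_comp, ← hJ.inner_left, hasIntegral_integral hf,
      ← scalar_apply_map_neg hJ ha hE x, integral_map measurable_neg.aemeasurable
        hf'.measurable.aestronglyMeasurable]
    simp
  rw [h.integral_eq hf', mul_apply_eq_comp, mul_apply_eq_comp, hJ.apply_apply]

end Anticommuting

end SpectralMeasure

/-! ### The direct sum belonging to `Je^Q` -/

section ExpForm

variable [CompleteSpace H] {J : H →L[ℂ] H} {E : SpectralMeasure H} {Q A : H →ₗ.[ℂ] H}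

theorem truncate_exp_mul (n : ℕ) :
    (fun t => truncate Real.exp n (-t)) * truncate Real.exp n
      = (window n).indicator fun _ => 1 := by
  ext t
  have hneg : -t ∈ window n ↔ t ∈ window n := by
    simp only [window, Set.mem_Icc, ← abs_le, abs_neg]
  by_cases h : t ∈ window n
  · simp only [Pi.mul_apply, truncate, Set.indicator_of_mem h, Set.indicator_of_mem (hneg.2 h)]
    rw [← Complex.ofReal_mul, ← Real.exp_add, neg_add_cancel, Real.exp_zero, Complex.ofReal_one]
  · simp [truncate, h]

/-- `J e^Q J` is the inverse of `e^Q`. -/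
theorem mem_graph_exp_symmetry (hJ : IsFundamentalSymmetry J) (ha : Anticommutes J Q)
    (hQ : E.IsIntegral (fun t => t) Q) (hA : E.IsIntegral Real.exp A) {x y : H}
    (h : (x, y) ∈ A.graph) : (J y, J x) ∈ A.graph := by
  rw [hA.mem_graph_iff Real.continuous_exp] at h ⊢
  intro n
  have ht := bddMeas_truncate Real.continuous_exp n
  have hw := BddMeas.indicator_const (measurableSet_window n) 1
  have ht' : BddMeas fun t => truncate Real.exp n (-t) := ht.comp measurable_neg
  rw [← SpectralMeasure.integral_indicator (measurableSet_window n),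
    SpectralMeasure.integral_apply_symmetry hJ ha hQ hw,
    SpectralMeasure.integral_apply_symmetry hJ ha hQ ht]
  congr 1
  have e1 : (fun t => (window n).indicator (fun _ => (1 : ℂ)) (-t))
      = (window n).indicator fun _ => 1 := by
    ext t
    have hneg : -t ∈ window n ↔ t ∈ window n := by
      simp only [window, Set.mem_Icc, ← abs_le, abs_neg]
    by_cases h : t ∈ window n <;> simp [h, hneg]
  have e2 : (fun t => truncate Real.exp n (-t)) * (window n).indicator (fun _ => 1)
      = fun t => truncate Real.exp n (-t) := by
    ext t
    have hneg : -t ∈ window n ↔ t ∈ window n := by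
      simp only [window, Set.mem_Icc, ← abs_le, abs_neg]
    by_cases h : t ∈ window n <;> simp [h, hneg, truncate]
  -- The window indicator factors as truncated `e^{-t}` times truncated `e^t`. The second factor
  -- turns `x` into `E(window n) y`, and the window is then absorbed by the first.
  rw [e1, ← truncate_exp_mul n, SpectralMeasure.integral_mul ht' ht, ← h n,
    ← SpectralMeasure.integral_indicator (measurableSet_window n),
    ← SpectralMeasure.integral_mul ht' hw, e2]

/-- The operator `I + e^Q` is onto. -/
theorem exists_mem_graph_exp (hA : E.IsIntegral Real.exp A) (h : H) :
    ∃ f, (f, h - f) ∈ A.graph := by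
  have hc : Continuous fun t : ℝ => (1 + Real.exp t)⁻¹ :=
    Continuous.inv₀ (by fun_prop) fun t => (by positivity)
  have hr : BddMeas fun t => (((1 + Real.exp t)⁻¹ : ℝ) : ℂ) := by
    refine ⟨(Complex.continuous_ofReal.comp hc).measurable, 1, fun t => ?_⟩
    rw [Complex.norm_real, Real.norm_of_nonneg (by positivity)]
    exact inv_le_one_of_one_le₀ (by linarith [Real.exp_pos t])
  -- The witness is `(I + e^Q)⁻¹h`, available as a bounded integral.
  refine ⟨E.integral (fun t => (((1 + Real.exp t)⁻¹ : ℝ) : ℂ)) h, ?_⟩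
  rw [hA.mem_graph_iff Real.continuous_exp]
  intro n
  have ht := bddMeas_truncate Real.continuous_exp n
  have hw := BddMeas.indicator_const (measurableSet_window n) 1
  rw [map_sub, sub_eq_iff_eq_add, ← SpectralMeasure.integral_mul ht hr,
    ← SpectralMeasure.integral_indicator (measurableSet_window n),
    ← SpectralMeasure.integral_mul hw hr, ← add_apply,
    ← SpectralMeasure.integral_add (ht.mul hr) (hw.mul hr)]
  congr 2
  ext t
  by_cases h : t ∈ window n
  · have h0 : (0 : ℝ) < 1 + Real.exp t := by positivity
    simp only [Pi.add_apply, Pi.mul_apply, truncate, Set.indicator_of_mem h]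
    rw [one_mul, ← Complex.ofReal_mul, ← Complex.ofReal_add, ← Complex.ofReal_one,
      Complex.ofReal_inj]
    field_simp
    ring
  · simp [truncate, h]

/-- `(e^Qx, x)` is the integral of a positive function against a measure of mass `‖x‖² > 0`. -/
theorem re_inner_pos_of_mem_graph (hA : E.IsIntegral Real.exp A) {x y : H}
    (h : (x, y) ∈ A.graph) (h0 : x ≠ 0) : 0 < (⟪x, y⟫_ℂ).re := by
  obtain ⟨u, hu, hu2⟩ := (LinearPMap.mem_graph_iff A).1 h
  simp only at hu hu2
  subst hu hu2
  rw [hA.inner_eq, Complex.ofReal_re]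
  have : NeZero (E.scalar (u : H)) := ⟨by
    intro hz
    have := E.real_scalar_univ (u : H)
    rw [hz] at this
    exact h0 (by simpa using this.symm)⟩
  exact integral_exp_pos (hA.integrable Real.continuous_exp u)

theorem eq_zero_of_mem_graph_neg (hA : E.IsIntegral Real.exp A) {x : H}
    (h : (x, -x) ∈ A.graph) : x = 0 := by
  by_contra h0
  have h1 := re_inner_pos_of_mem_graph hA h h0
  have h2 : (⟪x, x⟫_ℂ).re = ‖x‖ ^ 2 := (norm_sq_eq_re_inner (𝕜 := ℂ) x).symm
  rw [inner_neg_right, Complex.neg_re, h2] at h1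
  nlinarith [sq_nonneg ‖x‖]

theorem inner_eq_of_mem_graph (hA : E.IsIntegral Real.exp A) {x y x' y' : H}
    (h : (x, y) ∈ A.graph) (h' : (x', y') ∈ A.graph) : ⟪x', y⟫_ℂ = ⟪y', x⟫_ℂ := by
  obtain ⟨u, hu, hu2⟩ := (LinearPMap.mem_graph_iff A).1 h
  obtain ⟨v, hv, hv2⟩ := (LinearPMap.mem_graph_iff A).1 h'
  simp only at hu hu2 hv hv2
  subst hu hu2 hv hv2
  exact hA.symmetric Real.continuous_exp u v

theorem IsFundamentalSymmetry.neg (hJ : IsFundamentalSymmetry J) :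
    IsFundamentalSymmetry (-J) :=
  ⟨hJ.isSelfAdjoint.neg, by rw [neg_mul_neg, hJ.sq_eq_one]⟩

/-- Subtracting from `f` a vector of `Lm` with the same `H₋`-component leaves a vector of `H₊` that
is orthogonal to `Lp`. The `H₊`-components of `Lp` fill `H₊`, so it is zero. -/
theorem eq_indefOrthogonal (hJ : IsFundamentalSymmetry J) {Lp Lm : Submodule ℂ H}
    (hp : ∀ h, J h = h → ∃ l ∈ Lp, l + J l = (2 : ℂ) • h)
    (hm : ∀ h, J h = -h → ∃ l ∈ Lm, l - J l = (2 : ℂ) • h)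
    (ho : ∀ a ∈ Lp, ∀ b ∈ Lm, ⟪a, J b⟫_ℂ = 0) : Lm = indefOrthogonal J Lp := by
  refine le_antisymm (fun b hb => mem_indefOrthogonal.2 fun a h => ho a h b hb) fun f hf => ?_
  obtain ⟨l, hl, e⟩ := hm _ (hJ.half_sub_mem f)
  rw [smul_smul, mul_inv_cancel₀ two_ne_zero, one_smul] at e
  have hg : J (f - l) = f - l := by
    rw [map_sub]
    linear_combination (norm := module) e
  obtain ⟨m, hm', e2⟩ := hp _ hg
  have h1 : ⟪m, J (f - l)⟫_ℂ = 0 := by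
    rw [map_sub, inner_sub_right, mem_indefOrthogonal.1 hf m hm', ho m hm' l hl, sub_zero]
  have h2 : ⟪(2 : ℂ) • (f - l), f - l⟫_ℂ = 0 := by
    rw [← e2, inner_add_left, hJ.inner_left, h1, add_zero]
    rwa [hg] at h1
  rw [inner_smul_left] at h2
  have h3 : f - l = 0 := by simpa using h2
  rwa [sub_eq_zero.1 h3]

omit [CompleteSpace H] in
theorem mem_graph_compPMap {x y : H} :
    (x, y) ∈ ((J : H →ₗ[ℂ] H).compPMap A).graph ↔ ∃ z, (x, z) ∈ A.graph ∧ J z = y := by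
  simp only [LinearPMap.mem_graph_iff]
  constructor
  · rintro ⟨u, hu, hu2⟩
    exact ⟨A u, ⟨u, hu, rfl⟩, hu2⟩
  · rintro ⟨z, ⟨u, hu, rfl⟩, e⟩
    exact ⟨u, hu, e⟩

theorem mem_graph_compPMap_iff (hJ : IsFundamentalSymmetry J) {x y : H} :
    (x, y) ∈ ((J : H →ₗ[ℂ] H).compPMap A).graph ↔ (x, J y) ∈ A.graph := by
  rw [mem_graph_compPMap]
  constructor
  · rintro ⟨z, h, rfl⟩
    rwa [hJ.apply_apply]
  · intro h
    exact ⟨J y, h, hJ.apply_apply y⟩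

/-- `J e^Q` is the operator of a `J`-orthogonal direct sum. -/
theorem exists_isDirectSumPair_of_exp (hJ : IsFundamentalSymmetry J) (ha : Anticommutes J Q)
    (hQ : E.IsIntegral (fun t => t) Q) (hA : E.IsIntegral Real.exp A) :
    ∃ Lp Lm : Submodule ℂ H, IsDirectSumPair J Lp Lm ∧
      (J : H →ₗ[ℂ] H).compPMap A = directSumOperator Lp Lm := by
  -- The eigenspaces of `Je^Q` for `1` and `-1`, written as `e^Qx = Jx` and `e^Qx = -Jx`.
  let Lp : Submodule ℂ H := A.graph.comap (LinearMap.id.prod (J : H →ₗ[ℂ] H))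
  let Lm : Submodule ℂ H := A.graph.comap (LinearMap.id.prod (-(J : H →ₗ[ℂ] H)))
  have memp : ∀ x, x ∈ Lp ↔ (x, J x) ∈ A.graph := fun x => Iff.rfl
  have memm : ∀ x, x ∈ Lm ↔ (x, -J x) ∈ A.graph := fun x => Iff.rfl
  have hp : ∀ h, J h = h → ∃ l ∈ Lp, l + J l = (2 : ℂ) • h := by
    intro h hh
    -- Solve `f + e^Qf = 2h`. By the inversion symmetry `2h - Jf` is mapped to `Jf`, so `d = f + Jf
    -- - 2h` satisfies `e^Qd = -d` and vanishes; then `e^Qf = 2h - f = Jf`.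
    obtain ⟨f, hf⟩ := exists_mem_graph_exp hA ((2 : ℂ) • h)
    have h1 := A.graph.sub_mem hf (mem_graph_exp_symmetry hJ ha hQ hA hf)
    rw [map_sub, map_smul, hh, Prod.mk_sub_mk] at h1
    have h2 := eq_zero_of_mem_graph_neg hA (x := f - ((2 : ℂ) • h - J f))
      (by convert h1 using 2; abel)
    have h3 : f + J f = (2 : ℂ) • h := by
      rw [← sub_eq_zero, ← h2]
      abel
    refine ⟨f, (memp f).2 ?_, h3⟩
    rwa [← h3, add_sub_cancel_left] at hf
  have hm : ∀ h, J h = -h → ∃ l ∈ Lm, l - J l = (2 : ℂ) • h := by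
    intro h hh
    obtain ⟨f, hf⟩ := exists_mem_graph_exp hA ((2 : ℂ) • h)
    have h1 := A.graph.add_mem hf (mem_graph_exp_symmetry hJ ha hQ hA hf)
    rw [map_sub, map_smul, hh, Prod.mk_add_mk] at h1
    have h2 := eq_zero_of_mem_graph_neg hA (x := f + ((2 : ℂ) • -h - J f))
      (by convert h1 using 2; module)
    have h3 : f - J f = (2 : ℂ) • h := by
      rw [← sub_eq_zero, ← h2]
      module
    refine ⟨f, (memm f).2 ?_, h3⟩
    rwa [← h3, sub_sub_cancel_left] at hf
  have ho : ∀ a ∈ Lp, ∀ b ∈ Lm, ⟪a, J b⟫_ℂ = 0 := by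
    intro a h b hb
    have h1 := inner_eq_of_mem_graph hA ((memm b).1 hb) ((memp a).1 h)
    rw [inner_neg_right, hJ.inner_left] at h1
    exact self_eq_neg.1 h1.symm
  have eqm : Lm = indefOrthogonal J Lp := eq_indefOrthogonal hJ hp hm ho
  have eqp : Lp = indefOrthogonal J Lm := by
    -- Replacing `J` by `-J` exchanges the roles of the two subspaces. The resulting description of
    -- `Lp` as a complement gives its closedness.
    have h1 := eq_indefOrthogonal hJ.neg (Lp := Lm) (Lm := Lp)
      (fun h hh => by
        obtain ⟨l, hl, e⟩ := hm h (neg_eq_iff_eq_neg.1 hh)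
        exact ⟨l, hl, by simpa [sub_eq_add_neg] using e⟩)
      (fun h hh => by
        obtain ⟨l, hl, e⟩ := hp h (neg_injective hh)
        exact ⟨l, hl, by simpa using e⟩)
      (fun b hb a h => by
        rw [neg_apply, inner_neg_right, ← hJ.inner_left, ← inner_conj_symm, ho a h b hb]
        simp)
    rw [h1]
    ext x
    simp [mem_indefOrthogonal]
  have hpos : IsPositive J Lp := fun f hf h0 =>
    re_inner_pos_of_mem_graph hA ((memp f).1 hf) h0
  have hcl : IsClosed (Lp : Set H) := by
    rw [eqp]
    exact isClosed_indefOrthogonal J Lm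
  have hpair : IsDirectSumPair J Lp Lm := ⟨hJ.isMaximalPositive_of_surj hcl hpos hp, eqm⟩
  refine ⟨Lp, Lm, hpair, LinearPMap.eq_of_eq_graph ?_⟩
  ext ⟨x, y⟩
  rw [mem_graph_compPMap_iff hJ, mem_graph_directSumOperator hpair.disjoint]
  constructor
  · intro h
    have h2 := mem_graph_exp_symmetry hJ ha hQ hA h
    rw [hJ.apply_apply] at h2
    -- `Je^Q` swaps `x` and `y`, so half their sum and half their difference are eigenvectors for
    -- `1` and `-1`.
    refine ⟨(2 : ℂ)⁻¹ • (x + y), (memp _).2 ?_, (2 : ℂ)⁻¹ • (x - y), (memm _).2 ?_, ?_⟩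
    · have := A.graph.smul_mem (2 : ℂ)⁻¹ (A.graph.add_mem h h2)
      rwa [Prod.mk_add_mk, Prod.smul_mk, ← map_add, ← map_smul, add_comm y x] at this
    · have := A.graph.smul_mem (2 : ℂ)⁻¹ (A.graph.sub_mem h h2)
      rwa [Prod.mk_sub_mk, Prod.smul_mk, ← map_sub, ← map_smul, ← neg_sub x y, smul_neg,
        map_neg] at this
    · rw [half_add_half, Prod.mk.injEq]
      exact ⟨rfl, by module⟩
  · rintro ⟨a, h, b, hb, e⟩
    rw [Prod.mk.injEq] at e
    obtain ⟨rfl, rfl⟩ := e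
    have := A.graph.add_mem ((memp a).1 h) ((memm b).1 hb)
    rwa [Prod.mk_add_mk, ← sub_eq_add_neg, ← map_sub] at this

end ExpForm

/-- The operator `J A J`. -/
def conjPMap (J : H →L[ℂ] H) (A : H →ₗ.[ℂ] H) : H →ₗ.[ℂ] H where
  domain := A.domain.comap (J : H →ₗ[ℂ] H)
  toFun := (J : H →ₗ[ℂ] H) ∘ₗ A.toFun ∘ₗ (J : H →ₗ[ℂ] H).submoduleComap A.domain

/-! ### Conjugation by `J` and negation -/

section Adjoint

variable [CompleteSpace H] {J : H →L[ℂ] H}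

theorem mem_graph_conjPMap (hJ : IsFundamentalSymmetry J) {A : H →ₗ.[ℂ] H} {x y : H} :
    (x, y) ∈ (conjPMap J A).graph ↔ (J x, J y) ∈ A.graph := by
  simp only [LinearPMap.mem_graph_iff]
  constructor
  · rintro ⟨u, rfl, rfl⟩
    exact ⟨⟨J u, u.2⟩, rfl, (hJ.apply_apply _).symm⟩
  · rintro ⟨u, hu, hu2⟩
    have hx : J x ∈ A.domain := hu ▸ u.2
    refine ⟨⟨x, hx⟩, rfl, ?_⟩
    have : u = ⟨J x, hx⟩ := Subtype.ext hu
    rw [this] at hu2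
    change J (A ⟨J x, hx⟩) = y
    rw [hu2, hJ.apply_apply]

theorem mem_graph_directSumOperator_image (hJ : IsFundamentalSymmetry J)
    {Lp Lm : Submodule ℂ H} (h : IsDirectSumPair J Lp Lm) {x y : H} :
    (x, y) ∈ (directSumOperator (image J Lp) (image J Lm)).graph ↔
      (J x, J y) ∈ (directSumOperator Lp Lm).graph := by
  rw [mem_graph_directSumOperator h.disjoint,
    mem_graph_directSumOperator (hJ.isDirectSumPair_image h).disjoint]
  constructor
  · rintro ⟨a, ha, b, hb, e⟩
    rw [Prod.mk.injEq] at e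
    obtain ⟨rfl, rfl⟩ := e
    exact ⟨J a, hJ.mem_image_iff.1 ha, J b, hJ.mem_image_iff.1 hb, by rw [map_add, map_sub]⟩
  · rintro ⟨a, ha, b, hb, e⟩
    rw [Prod.mk.injEq] at e
    refine ⟨J a, mem_image.2 ⟨a, ha, rfl⟩, J b, mem_image.2 ⟨b, hb, rfl⟩, ?_⟩
    rw [← map_add, ← map_sub, ← e.1, ← e.2, hJ.apply_apply, hJ.apply_apply]

theorem isSelfAdjoint_neg {Q : H →ₗ.[ℂ] H} (hQ : IsSelfAdjoint Q) : IsSelfAdjoint (-Q) := by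
  have hd : Dense (Q.domain : Set H) := hQ.dense_domain
  rw [LinearPMap.isSelfAdjoint_def] at hQ ⊢
  apply LinearPMap.eq_of_eq_graph
  have hg : ∀ x y : H, (x, y) ∈ (-Q).graph ↔ (x, -y) ∈ Q.graph := by
    intro x y
    simp only [LinearPMap.mem_graph_iff, LinearPMap.neg_apply, neg_eq_iff_eq_neg]
    rfl
  rw [LinearPMap.adjoint_graph_eq_graph_adjoint (T := -Q) hd]
  ext ⟨x, y⟩
  rw [hg, Submodule.mem_adjoint_iff]
  nth_rewrite 2 [← hQ]
  rw [LinearPMap.adjoint_graph_eq_graph_adjoint hd, Submodule.mem_adjoint_iff]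
  constructor
  · intro h a b hab
    have := h a (-b) ((hg _ _).2 (by rwa [neg_neg]))
    simp only [inner_neg_left, inner_neg_right] at this ⊢
    linear_combination -this
  · intro h a b hab
    have := h a (-b) ((hg _ _).1 hab)
    simp only [inner_neg_left, inner_neg_right] at this ⊢
    linear_combination -this

omit [CompleteSpace H] in
theorem Anticommutes.neg {Q : H →ₗ.[ℂ] H} (h : Anticommutes J Q) : Anticommutes J (-Q) where
  mem_domain_iff := h.mem_domain_iff
  apply_eq x hx := by
    rw [LinearPMap.neg_apply, LinearPMap.neg_apply, map_neg, neg_inj]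
    exact h.apply_eq x hx

end Adjoint

end Krein

end

theorem corollary1 {H : Type*} [NormedAddCommGroup H] [InnerProductSpace ℂ H] [CompleteSpace H]
    (J : H →L[ℂ] H) (hJ : Krein.IsFundamentalSymmetry J) :
    (∀ C : H →ₗ.[ℂ] H, Krein.IsCOperator J C →
      Dense (C.domain : Set H) ∧ Krein.IsCOperator J C†) ∧
    (∀ Lp Lm : Submodule ℂ H, Krein.IsDirectSumPair J Lp Lm →
      Krein.IsDirectSumPair J (Krein.image J Lp) (Krein.image J Lm) ∧
      Krein.IsMaximalNegative J (Krein.image J Lm) ∧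
      (Krein.directSumOperator Lp Lm)† =
        Krein.directSumOperator (Krein.image J Lp) (Krein.image J Lm) ∧
      (∃! T : H →L[ℂ] H, Krein.IsTransitionOperator J T Lp Lm) ∧
      ∀ T : H →L[ℂ] H, Krein.IsTransitionOperator J T Lp Lm ↔
        Krein.IsTransitionOperator J (-T) (Krein.image J Lp) (Krein.image J Lm)) ∧
    (∀ Q C : H →ₗ.[ℂ] H, Krein.IsExpForm J Q C →
      Krein.IsExpForm J (-Q) C† ∧
      ∃ Lp Lm : Submodule ℂ H, Krein.IsDirectSumPair J Lp Lm ∧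
        C = Krein.directSumOperator Lp Lm ∧
        C† = Krein.directSumOperator (Krein.image J Lp) (Krein.image J Lm)) := by
  refine ⟨?_, ?_, ?_⟩
  · rintro C ⟨Lp, Lm, h, rfl⟩
    obtain ⟨T, hT⟩ := h.exists_transition hJ
    exact ⟨hT.dense_domain hJ h.disjoint, _, _, hJ.isDirectSumPair_image h, h.adjoint_eq hJ⟩
  · intro Lp Lm h
    obtain ⟨T, hT⟩ := h.exists_transition hJ
    exact ⟨hJ.isDirectSumPair_image h, hJ.isMaximalNegative_image (h.isMaximalNegative hJ),
      h.adjoint_eq hJ, ⟨T, hT, fun T' hT' => hT'.unique hJ hT⟩,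
      fun T => Krein.isTransitionOperator_neg_image_iff hJ⟩
  · rintro Q C ⟨hs, ha, A, ⟨E, hQ, hA⟩, rfl⟩
    obtain ⟨Lp, Lm, h, e⟩ := Krein.exists_isDirectSumPair_of_exp hJ ha hQ hA
    have hadj := h.adjoint_eq hJ
    refine ⟨⟨Krein.isSelfAdjoint_neg hs, ha.neg, Krein.conjPMap J A,
      ⟨E.conj hJ, Krein.SpectralMeasure.isIntegral_conj_neg hJ ha hQ,
        hA.conj hJ (fun _ => Iff.rfl) fun _ => rfl⟩, ?_⟩, Lp, Lm, h, e, by rw [e, hadj]⟩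
    -- By duality `C* = JCJ`; with `C = JA` this is `J(JAJ)`, and `JAJ` is the exponential of `-Q`
    -- for the conjugated spectral measure.
    apply LinearPMap.eq_of_eq_graph
    ext ⟨x, y⟩
    rw [e, hadj, Krein.mem_graph_directSumOperator_image hJ h, ← e,
      Krein.mem_graph_compPMap_iff hJ, Krein.mem_graph_compPMap_iff hJ,
      Krein.mem_graph_conjPMap hJ]
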